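/- **Setting.** Let $T$ be a complete first-order theory in a language $\mathcal L$, and let $\Sigma(\bar x)$ be a partial type over $\emptyset$ in a tuple $\bar x=(x_i)_{i\in I}$ of variables, possibly infinite, each of a given sort of $T^{\mathrm{eq}}$. A *monster model* of $T$ is a model $\mathcal M\models T$ that is $\kappa$-saturated and strongly $\kappa$-homogeneous (every partial elementary map with domain of size $<\kappa$ extends to an automorphism) for some uncountable cardinal $\kappa$ with $|\mathcal L|<\kappa$ and $|I|<\kappa$. We consider tuples of elements of $\mathcal M^{\mathrm{eq}}$. Let $\mathrm{Autf}(\mathcal M)\le\mathrm{Aut}(\mathcal M)$ be the subgroup generated by the automorphisms that fix pointwise some $M_0\prec\mathcal M$. For tuples $\bar a,\bar b$ of length $<\kappa$, write $\bar a\equiv^L\bar b$ if $\bar b=\tau(\bar a)$ for some $\tau\in\mathrm{Autf}(\mathcal M)$. For tuples of arbitrary length, write $\bar a\equiv^L\bar b$ if in some elementary extension $N\succeq\mathcal M$ there are tuples $\bar a=\bar a_0,\dots,\bar a_n=\bar b$ and models $N_0,\dots,N_{n-1}\preceq N$ with $\bar a_k\equiv_{N_k}\bar a_{k+1}$ for all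 $k<n$ (for tuples of length $<\kappa$ the two notions coincide). Let $\Sigma(\mathcal M)$ be the set of realisations of $\Sigma$ in $\mathcal M^{\mathrm{eq}}$, and put $$\mathrm{Aut}(\Sigma(\mathcal M))=\{\sigma\restriction\Sigma(\mathcal M):\sigma\in\mathrm{Aut}(\mathcal M)\}.$$ For a cardinal $\lambda>0$ let $$\mathrm{Autf}^{\lambda}_{\mathrm{fix}}(\Sigma(\mathcal M))=\{\sigma\restriction\Sigma(\mathcal M):\sigma\in\mathrm{Aut}(\mathcal M),\ \bar a\equiv^L\sigma(\bar a)\text{ for every }\bar a=(a_i)_{i<\lambda}\text{ with all }a_i\models\Sigma\},$$ $$\mathrm{Autf}_{\mathrm{fix}}(\Sigma(\mathcal M))=\{\sigma\restriction\Sigma(\mathcal M):\sigma\in\mathrm{Aut}(\mathcal M),\ \bar a\equiv^L\sigma(\bar a)\text{ for an enumeration }\bar a\text{ of }\Sigma(\mathcal M)\}.$$ These are normal subgroups of $\mathrm{Aut}(\Sigma(\mathcal M))$. The relativised Lascar groups are the quotients $$\mathrm{Gal}_L^{\mathrm{fix},\lambda}(\Sigma(\mathcal M))=\mathrm{Aut}(\Sigma(\mathcal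 M))/\mathrm{Autf}^{\lambda}_{\mathrm{fix}}(\Sigma(\mathcal M)),\qquad \mathrm{Gal}_L^{\mathrm{fix}}(\Sigma(\mathcal M))=\mathrm{Aut}(\Sigma(\mathcal M))/\mathrm{Autf}_{\mathrm{fix}}(\Sigma(\mathcal M)).$$ **Proposition.** Let $0<\lambda\le\omega$. Up to isomorphism of groups, $\mathrm{Gal}_L^{\mathrm{fix},\lambda}(\Sigma(\mathcal M))$ does not depend on the choice of the monster model: for any two monster models $\mathcal M,\mathcal M'$ of $T$, $$\mathrm{Gal}_L^{\mathrm{fix},\lambda}(\Sigma(\mathcal M))\cong\mathrm{Gal}_L^{\mathrm{fix},\lambda}(\Sigma(\mathcal M')).$$ Moreover, for every elementary embedding $j:\mathcal M\to\mathcal M'$ there is an isomorphism $\eta$ between these groups such that $\eta([f\restriction\Sigma(\mathcal M)])=[f'\restriction\Sigma(\mathcal M')]$ whenever $f\in\mathrm{Aut}(\mathcal M)$ and $f'\in\mathrm{Aut}(\mathcal M')$ satisfy $f'\circ j=j\circ f$. In particular, the same holds with $\mathrm{Gal}_L^{\mathrm{fix}}$ in place of $\mathrm{Gal}_L^{\mathrm{fix},\lambda}$.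 -/

import Mathlib

open FirstOrder FirstOrder.Language Cardinal

universe u v w x y z

namespace RelLascar

/-! ## Automorphism groups -/

section Automorphisms

variable {L : FirstOrder.Language.{u, v}} {M : Type w} [L.Structure M]

/-- The group `Aut(M)` of automorphisms of a structure, under composition. -/
instance autGroup : Group (M ≃[L] M) where
  mul f g := f.comp g
  one := Language.Equiv.refl L M
  inv f := f.symm
  mul_assoc _ _ _ := rfl
  one_mul _ := rfl
  mul_one _ := rfl
  inv_mul_cancel f := f.symm_comp_self

theorem aut_mul_apply (f g : M ≃[L] M) (a : M) : (f * g) a = f (g a) := rfl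

theorem aut_one_apply (a : M) : (1 : M ≃[L] M) a = a := rfl

theorem aut_inv_apply (f : M ≃[L] M) (a : M) : f⁻¹ a = f.symm a := rfl

variable (L M) in
/-- `Autf(M)`: the subgroup of `Aut(M)` generated by the automorphisms that fix pointwise some
elementary substructure of `M`. -/
def Autf : Subgroup (M ≃[L] M) :=
  Subgroup.closure {f | ∃ M₀ : L.ElementarySubstructure M, ∀ a ∈ M₀, f a = a}

variable (L) in
/-- The image of an elementary substructure under an elementary embedding. -/
def mapSubstructure {N : Type x} [L.Structure N] (k : M ↪ₑ[L] N)
    (M₀ : L.ElementarySubstructure M) : L.ElementarySubstructure N where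
  toSubstructure := (M₀ : L.Substructure M).map k.toHom
  isElementary' := by
    intro n φ a
    let e : M₀ → (M₀ : L.Substructure M).map k.toHom := fun m => ⟨k m, ⟨m, m.2, rfl⟩⟩
    have he : Function.Bijective e := by
      refine ⟨fun m m' h => ?_, ?_⟩
      · exact Subtype.ext (k.injective (Subtype.ext_iff.1 h))
      · rintro ⟨_, m, hm, rfl⟩
        exact ⟨⟨m, hm⟩, rfl⟩
    let E : M₀ ≃[L] (M₀ : L.Substructure M).map k.toHom :=
      { toEquiv := Equiv.ofBijective e he
        map_fun' := by
          intro n f b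
          exact Subtype.ext (k.map_fun f _)
        map_rel' := by
          intro n r b
          exact k.map_rel r _ }
    have h1 : a = E ∘ (E.symm ∘ a) := by
      funext i
      exact (E.apply_symm_apply (a i)).symm
    have h2 : ((↑) : (M₀ : L.Substructure M).map k.toHom → N) ∘ a
        = k ∘ (M₀.subtype ∘ (E.symm ∘ a)) := by
      conv_lhs => rw [h1]
      rfl
    rw [h2, k.map_formula, M₀.subtype.map_formula]
    conv_rhs => rw [h1]
    exact (StrongHomClass.realize_formula E φ).symm

theorem mem_mapSubstructure {N : Type x} [L.Structure N] (k : M ↪ₑ[L] N)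
    (M₀ : L.ElementarySubstructure M) (b : N) :
    b ∈ mapSubstructure L k M₀ ↔ ∃ m ∈ M₀, k m = b :=
  Iff.rfl

/-! ## Monster models -/

variable (L) in
/-- `M` is `κ`-saturated: every set of formulas in one variable, with parameters from a set `A` of
fewer than `κ` elements, that is finitely satisfiable in `M` is realised in `M`. -/
def IsSaturated (κ : Cardinal.{w}) (M : Type w) [L.Structure M] : Prop :=
  ∀ A : Set M, #A < κ → ∀ p : Set (L.Formula (A ⊕ Unit)),
    (∀ q : Finset (L.Formula (A ⊕ Unit)), (q : Set (L.Formula (A ⊕ Unit))) ⊆ p →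
      ∃ b : M, ∀ φ ∈ q, φ.Realize (Sum.elim (fun a : A => (a : M)) fun _ => b)) →
    ∃ b : M, ∀ φ ∈ p, φ.Realize (Sum.elim (fun a : A => (a : M)) fun _ => b)

variable (L) in
/-- `M` is strongly `κ`-homogeneous: every partial elementary map of `M` whose domain has fewer
than `κ` elements extends to an automorphism of `M`. -/
def IsStronglyHomogeneous (κ : Cardinal.{w}) (M : Type w) [L.Structure M] : Prop :=
  ∀ A : Set M, #A < κ → ∀ f : A → M,
    (∀ φ : L.Formula A, φ.Realize (fun a : A => (a : M)) ↔ φ.Realize f) →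
    ∃ σ : M ≃[L] M, ∀ a : A, σ a = f a

variable (L) in
/-- `M` is a monster model, with `κ` as the bound for smallness: `κ` is uncountable and larger than
the language, and `M` is `κ`-saturated and strongly `κ`-homogeneous. -/
structure IsMonster (κ : Cardinal.{w}) (M : Type w) [L.Structure M] : Prop where
  aleph0_lt : ℵ₀ < κ
  card_language_lt : Cardinal.lift.{w} L.card < Cardinal.lift.{max u v} κ
  saturated : IsSaturated L κ M
  stronglyHomogeneous : IsStronglyHomogeneous L κ M

end Automorphisms

/-! ## Imaginaries -/

section Imaginaries

variable {L : FirstOrder.Language.{u, v}} {T : L.Theory}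

/-- A sort of `T^eq`: an `L`-formula `E(x, y)`, with `x` and `y` of the same finite length, that
defines an equivalence relation in every model of `T`. The sort of the models themselves is the one
given by the formula `x = y` in single variables. -/
structure EqSort (T : L.Theory) where
  arity : ℕ
  rel : L.Formula (Fin arity ⊕ Fin arity)
  equiv : ∀ M : Theory.ModelType.{u, v, max u v} T,
    Equivalence fun a b : Fin arity → M => rel.Realize (Sum.elim a b)

theorem EqSort.equivalence (S : EqSort T) (M : Theory.ModelType.{u, v, w} T) :
    Equivalence fun a b : Fin S.arity → M => S.rel.Realize (Sum.elim a b) := by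
  refine ⟨fun a => ?_, fun {a b} h => ?_, fun {a b c} h h' => ?_⟩
  · have key : T ⊨ᵇ (S.rel.relabel (Sum.elim id id) : L.Formula (Fin S.arity)) := by
      refine Theory.models_formula_iff.2 fun N v => ?_
      rw [Formula.realize_relabel]
      convert (S.equiv N).refl v using 1
      funext i
      cases i <;> rfl
    have := key.realize_formula M (v := a)
    rw [Formula.realize_relabel] at this
    convert this using 1
    funext i
    cases i <;> rfl
  · have key : T ⊨ᵇ (S.rel.imp (S.rel.relabel Sum.swap) :
        L.Formula (Fin S.arity ⊕ Fin S.arity)) := by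
      refine Theory.models_formula_iff.2 fun N v => ?_
      rw [Formula.realize_imp, Formula.realize_relabel]
      intro h
      have := (S.equiv N).symm (x := v ∘ Sum.inl) (y := v ∘ Sum.inr)
        (by rwa [Sum.elim_comp_inl_inr])
      convert this using 1
      funext i
      cases i <;> rfl
    have := key.realize_formula M (v := Sum.elim a b)
    rw [Formula.realize_imp, Formula.realize_relabel] at this
    convert this h using 1
    funext i
    cases i <;> rfl
  · let f₁ : Fin S.arity ⊕ Fin S.arity → Fin 3 × Fin S.arity := Sum.elim (Prod.mk 0) (Prod.mk 1)
    let f₂ : Fin S.arity ⊕ Fin S.arity → Fin 3 × Fin S.arity := Sum.elim (Prod.mk 1) (Prod.mk 2)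
    let f₃ : Fin S.arity ⊕ Fin S.arity → Fin 3 × Fin S.arity := Sum.elim (Prod.mk 0) (Prod.mk 2)
    have comp_elim : ∀ {X : Type (max u v)} (g : Fin 3 × Fin S.arity → X) (i j : Fin 3),
        g ∘ (Sum.elim (Prod.mk i) (Prod.mk j)) =
          Sum.elim (fun k => g (i, k)) (fun k => g (j, k)) := by
      intro X g i j
      funext k
      cases k <;> rfl
    have key : T ⊨ᵇ ((S.rel.relabel f₁).imp ((S.rel.relabel f₂).imp (S.rel.relabel f₃)) :
        L.Formula (Fin 3 × Fin S.arity)) := by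
      refine Theory.models_formula_iff.2 fun N v => ?_
      simp only [Formula.realize_imp, Formula.realize_relabel, f₁, f₂, f₃, comp_elim]
      exact (S.equiv N).trans
    have := key.realize_formula M (v := fun p => (![a, b, c] p.1) p.2)
    simp only [Formula.realize_imp, Formula.realize_relabel] at this
    have e₁ : (fun p : Fin 3 × Fin S.arity => (![a, b, c] p.1) p.2) ∘ f₁ = Sum.elim a b := by
      funext k
      cases k <;> rfl
    have e₂ : (fun p : Fin 3 × Fin S.arity => (![a, b, c] p.1) p.2) ∘ f₂ = Sum.elim b c := by
      funext k
      cases k <;> rfl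
    have e₃ : (fun p : Fin 3 × Fin S.arity => (![a, b, c] p.1) p.2) ∘ f₃ = Sum.elim a c := by
      funext k
      cases k <;> rfl
    rw [e₁, e₂, e₃] at this
    exact this h h'

/-- The definable equivalence relation of a sort, in a model. -/
def EqSort.setoid (S : EqSort T) (M : Theory.ModelType.{u, v, w} T) :
    Setoid (Fin S.arity → M) :=
  ⟨_, S.equivalence M⟩

/-- The elements of `M^eq` of a given sort. -/
def EqSort.Carrier (S : EqSort T) (M : Theory.ModelType.{u, v, w} T) : Type w :=
  Quotient (S.setoid M)

/-- The class of a real tuple, as an element of `M^eq`. -/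
def EqSort.cls (S : EqSort T) {M : Theory.ModelType.{u, v, w} T} (a : Fin S.arity → M) :
    S.Carrier M :=
  Quotient.mk (S.setoid M) a

theorem EqSort.cls_surjective (S : EqSort T) {M : Theory.ModelType.{u, v, w} T} :
    Function.Surjective (S.cls (M := M)) :=
  Quotient.mk_surjective

/-- The map `M^eq → N^eq` induced by an elementary embedding `M → N`, on a given sort. -/
def EqSort.map (S : EqSort T) {M : Theory.ModelType.{u, v, w} T} {N : Theory.ModelType.{u, v, x} T}
    (j : M ↪ₑ[L] N) : S.Carrier M → S.Carrier N :=
  Quotient.map (sa := S.setoid M) (sb := S.setoid N) (fun a => j ∘ a) fun a b h => by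
    change S.rel.Realize (Sum.elim (j ∘ a) (j ∘ b))
    rw [← Sum.comp_elim, j.map_formula]
    exact h

theorem EqSort.map_cls (S : EqSort T) {M : Theory.ModelType.{u, v, w} T}
    {N : Theory.ModelType.{u, v, x} T} (j : M ↪ₑ[L] N) (a : Fin S.arity → M) :
    S.map j (S.cls a) = S.cls (j ∘ a) :=
  rfl

/-- The action of `Aut(M)` on the elements of `M^eq` of a given sort. -/
instance EqSort.mulAction (S : EqSort T) (M : Theory.ModelType.{u, v, w} T) :
    MulAction (M ≃[L] M) (S.Carrier M) where
  smul f := S.map f.toElementaryEmbedding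
  one_smul a := by
    obtain ⟨a, rfl⟩ := S.cls_surjective a
    rfl
  mul_smul f g a := by
    obtain ⟨a, rfl⟩ := S.cls_surjective a
    rfl

theorem EqSort.smul_cls (S : EqSort T) {M : Theory.ModelType.{u, v, w} T} (f : M ≃[L] M)
    (a : Fin S.arity → M) : f • S.cls a = S.cls (f ∘ a) :=
  rfl

variable {I : Type y}

/-- Tuples of elements of `M^eq` of prescribed sorts. The group `Aut(M)` acts coordinatewise. -/
abbrev EqTuple (s : I → EqSort T) (M : Theory.ModelType.{u, v, w} T) : Type (max w y) :=
  ∀ i, (s i).Carrier M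

/-- The variables for representatives of a tuple of variables of the given sorts. -/
abbrev RepVar (s : I → EqSort T) : Type y := Σ i, Fin (s i).arity

/-- `r` is a family of representatives of the tuple `a` of elements of `M^eq`. -/
def IsRep {s : I → EqSort T} {M : Theory.ModelType.{u, v, w} T} (r : RepVar s → M)
    (a : EqTuple s M) : Prop :=
  ∀ i, (s i).cls (fun k => r ⟨i, k⟩) = a i

theorem exists_isRep {s : I → EqSort T} {M : Theory.ModelType.{u, v, w} T} (a : EqTuple s M) :
    ∃ r : RepVar s → M, IsRep r a := by
  choose r hr using fun i => (s i).cls_surjective (a i)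
  exact ⟨fun p => r p.1 p.2, hr⟩

/-- Image of a tuple of `M^eq` under an elementary embedding. -/
def mapTuple {s : I → EqSort T} {M : Theory.ModelType.{u, v, w} T}
    {N : Theory.ModelType.{u, v, x} T} (j : M ↪ₑ[L] N) (a : EqTuple s M) : EqTuple s N :=
  fun i => (s i).map j (a i)

theorem IsRep.map {s : I → EqSort T} {M : Theory.ModelType.{u, v, w} T}
    {N : Theory.ModelType.{u, v, x} T} (j : M ↪ₑ[L] N) {r : RepVar s → M} {a : EqTuple s M}
    (h : IsRep r a) : IsRep (j ∘ r) (mapTuple j a) := by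
  intro i
  change _ = (s i).map j (a i)
  rw [← h i]
  rfl

theorem isRep_map_iff {s : I → EqSort T} {M : Theory.ModelType.{u, v, w} T}
    {N : Theory.ModelType.{u, v, x} T} (j : M ↪ₑ[L] N) {r : RepVar s → M} {a : EqTuple s M} :
    IsRep (j ∘ r) (mapTuple j a) ↔ IsRep r a := by
  refine ⟨fun h i => ?_, IsRep.map j⟩
  obtain ⟨b, hb⟩ := (s i).cls_surjective (a i)
  have hi := h i
  change _ = (s i).map j (a i) at hi
  rw [← hb, EqSort.map_cls] at hi
  rw [← hb]
  have h2 := Quotient.exact hi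
  change (s i).rel.Realize (Sum.elim (j ∘ fun k => r ⟨i, k⟩) (j ∘ b)) at h2
  rw [← Sum.comp_elim, j.map_formula] at h2
  exact Quotient.sound h2

/-- A partial type over `∅` in variables of the given sorts of `M^eq`. An `L`-formula `φ` in the
variables for representatives is read as the formula of `T^eq` which says that some representatives
of the tuple satisfy `φ`; modulo `T^eq`, every formula of `T^eq` in these variables has this
form. -/
abbrev PartialType (s : I → EqSort T) : Type (max u v y) := Set (L.Formula (RepVar s))

/-- The set `Σ(M)` of realisations of a partial type `Σ`; it is invariant under `Aut(M)`. -/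
def PartialType.realisations {s : I → EqSort T} (Sig : PartialType s)
    (M : Theory.ModelType.{u, v, w} T) : SubMulAction (M ≃[L] M) (EqTuple s M) where
  carrier := {a | ∀ φ ∈ Sig, ∃ r : RepVar s → M, IsRep r a ∧ φ.Realize r}
  smul_mem' f a ha φ hφ := by
    obtain ⟨r, hr, h⟩ := ha φ hφ
    exact ⟨f ∘ r, hr.map f.toElementaryEmbedding, (StrongHomClass.realize_formula f φ).2 h⟩

/-- `a` and `b` have the same type over the set `A` of parameters, as tuples of `M^eq`. -/
def SameType {s : I → EqSort T} {M : Theory.ModelType.{u, v, w} T} (A : Set M)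
    (a b : EqTuple s M) : Prop :=
  ∀ φ : L.Formula (A ⊕ RepVar s),
    (∃ r : RepVar s → M, IsRep r a ∧ φ.Realize (Sum.elim (fun c : A => (c : M)) r)) ↔
    (∃ r : RepVar s → M, IsRep r b ∧ φ.Realize (Sum.elim (fun c : A => (c : M)) r))

end Imaginaries

/-! ## Auxiliary facts on formulas with infinitely many variables -/

section Formulas

variable {L : FirstOrder.Language.{u, v}}

theorem realize_congr_of_freeVar {A : Type y} [DecidableEq A] {M : Type w} [L.Structure M]
    (φ : L.Formula A) {a b : A → M} (h : ∀ i ∈ φ.freeVarFinset, a i = b i) :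
    φ.Realize a ↔ φ.Realize b := by
  have h1 : (BoundedFormula.restrictFreeVar φ (fun i => (i : A))).Realize a default ↔
      BoundedFormula.Realize φ b default :=
    BoundedFormula.realize_restrictFreeVar b fun i => h i i.2
  have h2 : (BoundedFormula.restrictFreeVar φ (fun i => (i : A))).Realize a default ↔
      BoundedFormula.Realize φ a default :=
    BoundedFormula.realize_restrictFreeVar a fun i => rfl
  exact h2.symm.trans h1

theorem exists_realize_of_elementary {A : Type y} {B : Type z} {M : Type w} [L.Structure M]
    [Nonempty M] {N : Type x} [L.Structure N] (j : M ↪ₑ[L] N) (φ : L.Formula (A ⊕ B)) (a : A → M)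
    (h : ∃ b : B → N, φ.Realize (Sum.elim (j ∘ a) b)) :
    ∃ b : B → M, φ.Realize (Sum.elim a b) := by
  classical
  obtain ⟨b, h⟩ := h
  let V := {q : B // Sum.inr q ∈ φ.freeVarFinset}
  have : Finite V := by
    refine Finite.of_injective (fun q : V => (⟨Sum.inr q.1, q.2⟩ : φ.freeVarFinset)) ?_
    intro q q' hq
    exact Subtype.ext (Sum.inr_injective (Subtype.ext_iff.1 hq))
  let f : φ.freeVarFinset → A ⊕ V := fun q =>
    match q with
    | ⟨Sum.inl c, _⟩ => Sum.inl c
    | ⟨Sum.inr p, hp⟩ => Sum.inr ⟨p, hp⟩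
  let ψ : L.Formula (A ⊕ V) := BoundedFormula.restrictFreeVar φ f
  have hN : (ψ.iExs V).Realize (j ∘ a) := by
    rw [Formula.realize_iExs]
    refine ⟨fun q => b q.1, ?_⟩
    refine (BoundedFormula.realize_restrictFreeVar (Sum.elim (j ∘ a) b) ?_).2 h
    rintro ⟨q | q, hq⟩ <;> rfl
  rw [j.map_formula, Formula.realize_iExs] at hN
  obtain ⟨c, hc⟩ := hN
  let b' : B → M := fun q =>
    if hq : Sum.inr q ∈ φ.freeVarFinset then c ⟨q, hq⟩ else Classical.arbitrary M
  refine ⟨b', (BoundedFormula.realize_restrictFreeVar (Sum.elim a b') ?_).1 hc⟩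
  rintro ⟨q | q, hq⟩
  · rfl
  · change c ⟨q, hq⟩ = if hq : Sum.inr q ∈ φ.freeVarFinset then c ⟨q, hq⟩ else Classical.arbitrary M
    rw [dif_pos (show Sum.inr q ∈ φ.freeVarFinset from hq)]

/-- Compactness for sets of formulas in arbitrarily many variables. -/
theorem exists_realize_of_finite {T : L.Theory} {A : Type z} (p : Set (L.Formula A))
    (h : ∀ q : Finset (L.Formula A), (q : Set (L.Formula A)) ⊆ p →
      ∃ (M : Theory.ModelType.{u, v, x} T) (a : A → M), ∀ φ ∈ q, φ.Realize a) :
    ∃ (N : Theory.ModelType.{u, v, max u v z} T) (a : A → N), ∀ φ ∈ p, φ.Realize a := by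
  classical
  have hsat : ((L.lhomWithConstants A).onTheory T ∪
      Formula.equivSentence '' p : L[[A]].Theory).IsSatisfiable := by
    rw [Theory.isSatisfiable_iff_isFinitelySatisfiable]
    intro q hq
    let q' : Finset (L.Formula A) :=
      (q.image Formula.equivSentence.symm).filter fun φ => φ ∈ p
    obtain ⟨M, a, ha⟩ := h q' (fun φ hφ => (Finset.mem_filter.1 hφ).2)
    let : (constantsOn A).Structure M := constantsOn.structure a
    have hT : M ⊨ (L.lhomWithConstants A).onTheory T :=
      (LHom.onTheory_model _ _).2 inferInstance
    have hM : M ⊨ (q : L[[A]].Theory) := by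
      refine ⟨fun ψ hψ => ?_⟩
      rcases hq hψ with h1 | ⟨φ, hφ, rfl⟩
      · exact hT.realize_of_mem ψ h1
      · refine (Formula.realize_equivSentence M φ).2 (ha φ ?_)
        exact Finset.mem_filter.2
          ⟨Finset.mem_image.2 ⟨_, hψ, Formula.equivSentence.symm_apply_apply φ⟩, hφ⟩
    exact Theory.Model.isSatisfiable M
  obtain ⟨P⟩ := hsat
  have hP := P.is_model
  let : L.Structure P := (L.lhomWithConstants A).reduct P
  have hexp : (L.lhomWithConstants A).IsExpansionOn P := LHom.isExpansionOn_reduct _ _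
  have hT : (P : Type _) ⊨ T :=
    (LHom.onTheory_model (L.lhomWithConstants A) T).1 (hP.mono Set.subset_union_left)
  refine ⟨Theory.ModelType.of T P, fun i => (L.con i : P), fun φ hφ => ?_⟩
  exact (Formula.realize_equivSentence (M := P) φ).1
    (hP.realize_of_mem _ (Set.subset_union_right ⟨φ, hφ, rfl⟩))

/-- Two elementary extensions of a model have a common elementary extension over it. -/
theorem exists_amalgam {T : L.Theory} {M : Theory.ModelType.{u, v, w} T}
    {N₁ N₂ : Theory.ModelType.{u, v, max u v w} T} (j₁ : M ↪ₑ[L] N₁) (j₂ : M ↪ₑ[L] N₂) :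
    ∃ (N : Theory.ModelType.{u, v, max u v w} T) (k₁ : N₁ ↪ₑ[L] N) (k₂ : N₂ ↪ₑ[L] N),
      k₁.comp j₁ = k₂.comp j₂ := by
  classical
  let p₁ : Set (L.Formula (N₁ ⊕ N₂)) :=
    {ψ | ∃ φ : L.Formula N₁, φ.Realize (fun b : N₁ => b) ∧ ψ = φ.relabel Sum.inl}
  let p₂ : Set (L.Formula (N₁ ⊕ N₂)) :=
    {ψ | ∃ φ : L.Formula N₂, φ.Realize (fun b : N₂ => b) ∧ ψ = φ.relabel Sum.inr}
  let p₃ : Set (L.Formula (N₁ ⊕ N₂)) :=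
    {ψ | ∃ m : M, ψ = Term.equal (Term.var (Sum.inl (j₁ m))) (Term.var (Sum.inr (j₂ m)))}
  obtain ⟨N, a, ha⟩ := exists_realize_of_finite (T := T) (A := N₁ ⊕ N₂) (p₁ ∪ p₂ ∪ p₃) (by
    intro q hq
    -- the conjunction of the formulas over `N₂` that occur
    let Q : Type _ := {ψ : L.Formula (N₁ ⊕ N₂) // ψ ∈ q ∧ ψ ∈ p₂}
    have : Finite Q := Finite.of_injective (fun ψ : Q => (⟨ψ.1, ψ.2.1⟩ : q))
      fun ψ ψ' h => Subtype.ext (congrArg (fun θ : q => (θ : L.Formula (N₁ ⊕ N₂))) h)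
    have hQ : ∀ ψ : Q, ∃ φ : L.Formula N₂,
      φ.Realize (fun b : N₂ => b) ∧ ψ.1 = φ.relabel Sum.inr := fun ψ => ψ.2.2
    choose F hF hF' using hQ
    let g : N₂ → M ⊕ N₂ := fun b =>
      if hb : ∃ m, j₂ m = b then Sum.inl hb.choose else Sum.inr b
    have hg : ∀ m, g (j₂ m) = Sum.inl m := by
      intro m
      have hb : ∃ m', j₂ m' = j₂ m := ⟨m, rfl⟩
      have : g (j₂ m) = Sum.inl hb.choose := dif_pos hb
      rw [this, j₂.injective hb.choose_spec]
    have hg' : ∀ b : N₂, Sum.elim (j₂ ∘ fun m : M => m) (fun b : N₂ => b) (g b) = b := by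
      intro b
      by_cases hb : ∃ m, j₂ m = b
      · have : g b = Sum.inl hb.choose := dif_pos hb
        rw [this]
        exact hb.choose_spec
      · have : g b = Sum.inr b := dif_neg hb
        rw [this]
        rfl
    obtain ⟨b, hb⟩ := exists_realize_of_elementary j₂ ((Formula.iInf F).relabel g)
      (fun m : M => m) ⟨fun b => b, by
        rw [Formula.realize_relabel, Formula.realize_iInf]
        intro ψ
        convert hF ψ using 1
        funext b
        exact hg' b⟩
    rw [Formula.realize_relabel, Formula.realize_iInf] at hb
    refine ⟨N₁, Sum.elim (fun b => b) (j₁ ∘ (Sum.elim (fun m : M => m) b ∘ g)), fun ψ hψ => ?_⟩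
    rcases hq hψ with (⟨φ, hφ, rfl⟩ | h2) | ⟨m, rfl⟩
    · rw [Formula.realize_relabel]
      exact hφ
    · have e := hF' ⟨ψ, hψ, h2⟩
      change ψ = _ at e
      rw [e, Formula.realize_relabel, Sum.elim_comp_inr, j₁.map_formula]
      exact hb _
    · rw [Formula.realize_equal]
      simp [hg])
  refine ⟨N, ⟨fun b => a (Sum.inl b), fun n φ c => ?_⟩, ⟨fun b => a (Sum.inr b), fun n φ c => ?_⟩,
    ?_⟩
  · have key : ∀ θ : L.Formula (Fin n), θ.Realize c →
        θ.Realize ((fun b => a (Sum.inl b)) ∘ c) := by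
      intro θ hθ
      have := ha ((θ.relabel c).relabel Sum.inl)
        (Or.inl (Or.inl ⟨θ.relabel c, by rw [Formula.realize_relabel]; exact hθ, rfl⟩))
      rw [Formula.realize_relabel, Formula.realize_relabel] at this
      exact this
    refine ⟨fun h => ?_, key φ⟩
    by_contra hc
    exact Formula.realize_not.1 (key φ.not (Formula.realize_not.2 hc)) h
  · have key : ∀ θ : L.Formula (Fin n), θ.Realize c →
        θ.Realize ((fun b => a (Sum.inr b)) ∘ c) := by
      intro θ hθ
      have := ha ((θ.relabel c).relabel Sum.inr)
        (Or.inl (Or.inr ⟨θ.relabel c, by rw [Formula.realize_relabel]; exact hθ, rfl⟩))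
      rw [Formula.realize_relabel, Formula.realize_relabel] at this
      exact this
    refine ⟨fun h => ?_, key φ⟩
    by_contra hc
    exact Formula.realize_not.1 (key φ.not (Formula.realize_not.2 hc)) h
  · ext m
    have := ha _ (Or.inr ⟨m, rfl⟩)
    rw [Formula.realize_equal] at this
    exact this

end Formulas

/-! ## Lascar equivalence -/

section LascarEquivalence

variable {L : FirstOrder.Language.{u, v}} {T : L.Theory} {I : Type y} {s : I → EqSort T}

/-- Lascar equivalence of small tuples of a monster model `M`: being conjugate under `Autf(M)`. -/
def LascarEquiv {M : Theory.ModelType.{u, v, w} T} (a b : EqTuple s M) : Prop :=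
  ∃ τ ∈ Autf L M, τ • a = b

/-- One step of Lascar equivalence: having the same type over some model. -/
def LascarStep {M : Theory.ModelType.{u, v, w} T} (a b : EqTuple s M) : Prop :=
  ∃ M₀ : L.ElementarySubstructure M, SameType (M₀ : Set M) a b

/-- Lascar equivalence of tuples of arbitrary length from a structure `M`. Tuples that are not small
for `M` have to be compared in a larger model: in some elementary extension `N` of `M` they are
joined by a finite sequence of tuples in which consecutive ones have the same type over some
model `N₀ ≼ N`. -/
def LongLascarEquiv {M : Theory.ModelType.{u, v, w} T} (a b : EqTuple s M) : Prop :=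
  ∃ (N : Theory.ModelType.{u, v, max u v w} T) (j : M ↪ₑ[L] N),
    Relation.ReflTransGen LascarStep (mapTuple j a) (mapTuple j b)

/-! ### Long Lascar equivalence is an equivalence relation, invariant under automorphisms -/

theorem SameType.symm {M : Theory.ModelType.{u, v, w} T} {A : Set M} {a b : EqTuple s M}
    (h : SameType A a b) : SameType A b a :=
  fun φ => (h φ).symm

theorem LascarStep.symm {M : Theory.ModelType.{u, v, w} T} {a b : EqTuple s M}
    (h : LascarStep a b) : LascarStep b a := by
  obtain ⟨M₀, h⟩ := h
  exact ⟨M₀, h.symm⟩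

theorem mapTuple_comp {M : Theory.ModelType.{u, v, w} T} {N : Theory.ModelType.{u, v, x} T}
    {P : Theory.ModelType.{u, v, z} T} (k : N ↪ₑ[L] P) (j : M ↪ₑ[L] N) (a : EqTuple s M) :
    mapTuple (k.comp j) a = mapTuple k (mapTuple j a) := by
  obtain ⟨r, hr⟩ := exists_isRep a
  funext i
  change (s i).map (k.comp j) (a i) = (s i).map k ((s i).map j (a i))
  rw [← hr i]
  rfl

/-- Satisfaction of a formula with parameters by a tuple of `M^eq` is preserved and reflected by
elementary embeddings. -/
theorem exists_isRep_realize_map {P : Type z} {M : Theory.ModelType.{u, v, w} T}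
    {N : Theory.ModelType.{u, v, x} T} (j : M ↪ₑ[L] N) (a : EqTuple s M) (c : P → M)
    (φ : L.Formula (P ⊕ RepVar s)) :
    (∃ r : RepVar s → N, IsRep r (mapTuple j a) ∧ φ.Realize (Sum.elim (j ∘ c) r)) ↔
      ∃ r : RepVar s → M, IsRep r a ∧ φ.Realize (Sum.elim c r) := by
  classical
  constructor
  · rintro ⟨r, hr, h⟩
    obtain ⟨r₀, hr₀⟩ := exists_isRep a
    -- the finitely many coordinates whose representatives occur in `φ`
    let I₀ : Finset I := φ.freeVarFinset.biUnion
      (Sum.elim (fun _ => ∅) (fun p : RepVar s => {p.1}))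
    have mem_I₀ : ∀ p : RepVar s, Sum.inr p ∈ φ.freeVarFinset → p.1 ∈ I₀ := by
      intro p hp
      refine Finset.mem_biUnion.2 ⟨_, hp, ?_⟩
      simp
    let e : (i : I) → Fin (s i).arity ⊕ Fin (s i).arity → (P ⊕ RepVar s) ⊕ RepVar s := fun i =>
      Sum.elim (fun k => Sum.inr ⟨i, k⟩) (fun k => Sum.inl (Sum.inr ⟨i, k⟩))
    let ψ : L.Formula ((P ⊕ RepVar s) ⊕ RepVar s) :=
      (φ.relabel (Sum.map Sum.inl id)) ⊓ Formula.iInf fun i : I₀ => (s i).rel.relabel (e i)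
    obtain ⟨b, hb⟩ := exists_realize_of_elementary j ψ (Sum.elim c r₀) ⟨r, by
      rw [Formula.realize_inf, Formula.realize_iInf, Formula.realize_relabel]
      constructor
      · convert h using 1
        funext q
        cases q <;> rfl
      · rintro ⟨i, hi⟩
        rw [Formula.realize_relabel]
        have h1 : (s i).rel.Realize (Sum.elim (fun k => r ⟨i, k⟩) fun k => j (r₀ ⟨i, k⟩)) :=
          Quotient.exact ((hr i).trans ((hr₀.map j) i).symm)
        convert h1 using 1
        funext q
        cases q <;> rfl⟩
    rw [Formula.realize_inf, Formula.realize_iInf, Formula.realize_relabel] at hb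
    obtain ⟨hb₁, hb₂⟩ := hb
    let r' : RepVar s → M := fun p => if p.1 ∈ I₀ then b p else r₀ p
    refine ⟨r', fun i => ?_, ?_⟩
    · by_cases hi : i ∈ I₀
      · have h1 := hb₂ ⟨i, hi⟩
        rw [Formula.realize_relabel] at h1
        have h2 : (s i).rel.Realize (Sum.elim (fun k => b ⟨i, k⟩) fun k => r₀ ⟨i, k⟩) := by
          convert h1 using 1
          funext q
          cases q <;> rfl
        have h3 : (fun k => r' ⟨i, k⟩) = fun k => b ⟨i, k⟩ := by
          funext k
          exact if_pos hi
        rw [h3, ← hr₀ i]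
        exact Quotient.sound h2
      · have h3 : (fun k => r' ⟨i, k⟩) = fun k => r₀ ⟨i, k⟩ := by
          funext k
          exact if_neg hi
        rw [h3, hr₀ i]
    · refine (realize_congr_of_freeVar φ ?_).1 hb₁
      rintro (q | q) hq
      · rfl
      · exact (if_pos (mem_I₀ q hq)).symm
  · rintro ⟨r, hr, h⟩
    refine ⟨j ∘ r, hr.map j, ?_⟩
    rw [← Sum.comp_elim, j.map_formula]
    exact h

theorem LascarStep.map {M : Theory.ModelType.{u, v, w} T} {N : Theory.ModelType.{u, v, x} T}
    (j : M ↪ₑ[L] N) {a b : EqTuple s M} (h : LascarStep a b) :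
    LascarStep (mapTuple j a) (mapTuple j b) := by
  obtain ⟨M₀, h⟩ := h
  refine ⟨mapSubstructure L j M₀, fun φ => ?_⟩
  choose g hg hg' using fun c : (mapSubstructure L j M₀ : Set N) => c.2
  let φ' : L.Formula ((M₀ : Set M) ⊕ RepVar s) :=
    φ.relabel (Sum.map (fun c => (⟨g c, hg c⟩ : (M₀ : Set M))) id)
  have key : ∀ r : RepVar s → N,
      φ'.Realize (Sum.elim (j ∘ fun c : (M₀ : Set M) => (c : M)) r) ↔
      φ.Realize (Sum.elim (fun c : (mapSubstructure L j M₀ : Set N) => (c : N)) r) := by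
    intro r
    rw [Formula.realize_relabel]
    have : Sum.elim (j ∘ fun c : (M₀ : Set M) => (c : M)) r ∘
        Sum.map (fun c => (⟨g c, hg c⟩ : (M₀ : Set M))) id =
        Sum.elim (fun c : (mapSubstructure L j M₀ : Set N) => (c : N)) r := by
      funext q
      rcases q with q | q
      · exact hg' q
      · rfl
    rw [this]
  simp only [← key]
  rw [exists_isRep_realize_map, exists_isRep_realize_map]
  exact h φ'

theorem LongLascarEquiv.refl {M : Theory.ModelType.{u, v, w} T} (a : EqTuple s M) :
    LongLascarEquiv a a := by
  obtain ⟨N, r, hr⟩ := exists_realize_of_finite.{u, v, w, w} (T := T) (A := M)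
    {φ | φ.Realize (fun m : M => m)} fun q hq => ⟨M, fun m => m, fun φ hφ => hq hφ⟩
  refine ⟨N, ⟨r, fun n φ c => ?_⟩, Relation.ReflTransGen.refl⟩
  have key : ∀ θ : L.Formula (Fin n), θ.Realize c → θ.Realize (r ∘ c) := by
    intro θ hθ
    have := hr (θ.relabel c) (by
      change (θ.relabel c).Realize _
      rw [Formula.realize_relabel]
      exact hθ)
    rwa [Formula.realize_relabel] at this
  refine ⟨fun h => ?_, key φ⟩
  by_contra hc
  exact Formula.realize_not.1 (key φ.not (Formula.realize_not.2 hc)) h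

theorem LongLascarEquiv.symm {M : Theory.ModelType.{u, v, w} T} {a b : EqTuple s M}
    (h : LongLascarEquiv a b) : LongLascarEquiv b a := by
  obtain ⟨N, j, h⟩ := h
  exact ⟨N, j, Relation.ReflTransGen.mono (fun _ _ => LascarStep.symm) _ _
    (Relation.ReflTransGen.swap _ _ h)⟩

theorem LongLascarEquiv.trans {M : Theory.ModelType.{u, v, w} T} {a b c : EqTuple s M}
    (h : LongLascarEquiv a b) (h' : LongLascarEquiv b c) : LongLascarEquiv a c := by
  obtain ⟨N₁, j₁, h₁⟩ := h
  obtain ⟨N₂, j₂, h₂⟩ := h'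
  obtain ⟨N, k₁, k₂, hk⟩ := exists_amalgam j₁ j₂
  refine ⟨N, k₁.comp j₁, Relation.ReflTransGen.trans (b := mapTuple (k₁.comp j₁) b) ?_ ?_⟩
  · rw [mapTuple_comp, mapTuple_comp]
    exact Relation.ReflTransGen.lift (mapTuple k₁) (fun _ _ => LascarStep.map k₁) _ _ h₁
  · rw [hk, mapTuple_comp, mapTuple_comp]
    exact Relation.ReflTransGen.lift (mapTuple k₂) (fun _ _ => LascarStep.map k₂) _ _ h₂

/-- Long Lascar equivalence is invariant under automorphisms. -/
theorem LongLascarEquiv.smul {M : Theory.ModelType.{u, v, w} T} {a b : EqTuple s M}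
    (f : M ≃[L] M) (h : LongLascarEquiv a b) : LongLascarEquiv (f • a) (f • b) := by
  obtain ⟨N, j, h⟩ := h
  refine ⟨N, j.comp f⁻¹.toElementaryEmbedding, ?_⟩
  have key : ∀ c : EqTuple s M, mapTuple f⁻¹.toElementaryEmbedding (f • c) = c :=
    fun c => inv_smul_smul f c
  rw [mapTuple_comp, mapTuple_comp, key, key]
  exact h

theorem exists_isRep_realize_reindex {J : Type x} {P : Type z} (e : J → I)
    (he : Function.Injective e) {M : Theory.ModelType.{u, v, w} T} (a : EqTuple s M) (c : P → M)
    (φ : L.Formula (P ⊕ RepVar fun i => s (e i))) :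
    (∃ r : (RepVar fun i => s (e i)) → M, IsRep r (s := fun i => s (e i)) (fun i => a (e i)) ∧
        φ.Realize (Sum.elim c r)) ↔
      ∃ r : RepVar s → M, IsRep r a ∧
        (φ.relabel (Sum.map id fun p => (⟨e p.1, p.2⟩ : RepVar s))).Realize (Sum.elim c r) := by
  let g : (RepVar fun i => s (e i)) → RepVar s := fun p => ⟨e p.1, p.2⟩
  have hg : Function.Injective g := by
    rintro ⟨i, k⟩ ⟨i', k'⟩ h
    obtain rfl : i = i' := he (congrArg Sigma.fst h)
    have : k = k' := eq_of_heq (Sigma.mk.inj h).2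
    rw [this]
  constructor
  · rintro ⟨r, hr, h⟩
    obtain ⟨r₀, hr₀⟩ := exists_isRep a
    refine ⟨Function.extend g r r₀, fun i => ?_, ?_⟩
    · by_cases hi : ∃ i', e i' = i
      · obtain ⟨i, rfl⟩ := hi
        refine Eq.trans ?_ (hr i)
        change (s (e i)).cls _ = (s (e i)).cls _
        congr 1
        funext k
        exact hg.extend_apply r r₀ ⟨i, k⟩
      · rw [← hr₀ i]
        congr 1
        funext k
        refine Function.extend_apply' _ _ _ ?_
        rintro ⟨p, hp⟩
        exact hi ⟨p.1, congrArg Sigma.fst hp⟩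
    · rw [Formula.realize_relabel]
      convert h using 1
      funext q
      rcases q with q | q
      · rfl
      · exact hg.extend_apply r r₀ q
  · rintro ⟨r, hr, h⟩
    rw [Formula.realize_relabel] at h
    refine ⟨r ∘ g, fun i => hr (e i), ?_⟩
    convert h using 1
    funext q
    cases q <;> rfl

/-- Long Lascar equivalence passes to subtuples and to other enumerations. -/
theorem LongLascarEquiv.reindex {J : Type x} (e : J → I) (he : Function.Injective e)
    {M : Theory.ModelType.{u, v, w} T} {a b : EqTuple s M} (h : LongLascarEquiv a b) :
    LongLascarEquiv (s := fun i => s (e i)) (fun i => a (e i)) (fun i => b (e i)) := by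
  obtain ⟨N, j, h⟩ := h
  refine ⟨N, j, ?_⟩
  refine Relation.ReflTransGen.lift
    (fun (c : EqTuple s N) (i : J) => c (e i)) (fun c d hcd => ?_) _ _ h
  obtain ⟨M₀, hcd⟩ := hcd
  refine ⟨M₀, fun φ => ?_⟩
  rw [exists_isRep_realize_reindex e he, exists_isRep_realize_reindex e he]
  exact hcd _

end LascarEquivalence

/-! ## The relativised Lascar groups -/

section Groups

variable {L : FirstOrder.Language.{u, v}} {T : L.Theory} {I : Type y} {s : I → EqSort T}

instance autf_normal (M : Type w) [L.Structure M] : (Autf L M).Normal := by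
  refine ⟨fun f hf g => ?_⟩
  refine Subgroup.closure_induction (p := fun f _ => g * f * g⁻¹ ∈ Autf L M) ?_ ?_ ?_ ?_ hf
  · rintro f ⟨M₀, hf⟩
    refine Subgroup.subset_closure ⟨mapSubstructure L g.toElementaryEmbedding M₀, ?_⟩
    rintro _ ⟨m, hm, rfl⟩
    change g (f (g.symm (g m))) = g m
    rw [g.symm_apply_apply, hf m hm]
  · simp only [mul_one, mul_inv_cancel]
    exact one_mem _
  · intro f f' _ _ hf hf'
    have : g * (f * f') * g⁻¹ = (g * f * g⁻¹) * (g * f' * g⁻¹) := by group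
    rw [this]
    exact mul_mem hf hf'
  · intro f _ hf
    have : g * f⁻¹ * g⁻¹ = (g * f * g⁻¹)⁻¹ := by group
    rw [this]
    exact inv_mem hf

/-- The restriction map from `Aut(M)` to the permutations of `Σ(M)`. -/
def restrict (Sig : PartialType s) (M : Theory.ModelType.{u, v, w} T) :
    (M ≃[L] M) →* Equiv.Perm (Sig.realisations M) :=
  MulAction.toPermHom (M ≃[L] M) (Sig.realisations M)

/-- `Aut(Σ(M))`: the group of the restrictions to `Σ(M)` of the automorphisms of `M`. -/
abbrev AutSigma (Sig : PartialType s) (M : Theory.ModelType.{u, v, w} T) :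
    Subgroup (Equiv.Perm (Sig.realisations M)) :=
  (restrict Sig M).range

/-- The tuple obtained by concatenating a family of realisations of `Σ`. -/
def concat {Sig : PartialType s} {M : Theory.ModelType.{u, v, w} T} {K : Type z}
    (a : K → Sig.realisations M) : EqTuple (fun p : K × I => s p.2) M :=
  fun p => (a p.1 : EqTuple s M) p.2

theorem prodMap_smul_injective {G : Type w} {X : Type x} [Group G] [MulAction G X] (g : G) :
    Function.Injective fun p : X × I => (g • p.1, p.2) := by
  rintro ⟨a, i⟩ ⟨b, k⟩ h
  have h : (g • a, i) = (g • b, k) := h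
  rw [Prod.mk.injEq] at h
  exact Prod.ext (MulAction.injective g h.1) h.2

/-- The automorphisms `σ` of `M` such that `a ≡ᴸ σ(a)` for each tuple `a = (aᵢ)_{i < lam}` of
realisations of `Σ`. -/
def lascarFixingCard (Sig : PartialType s) (M : Theory.ModelType.{u, v, w} T)
    (lam : Cardinal.{0}) : Subgroup (M ≃[L] M) where
  carrier := {σ | ∀ a : lam.out → Sig.realisations M, LascarEquiv (concat a) (σ • concat a)}
  one_mem' a := ⟨1, one_mem _, rfl⟩
  mul_mem' {σ σ'} h h' a := by
    obtain ⟨τ', hτ', e'⟩ := h' a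
    obtain ⟨τ, hτ, e⟩ := h (σ' • a)
    refine ⟨τ * τ', mul_mem hτ hτ', ?_⟩
    have e : τ • (σ' • concat a) = σ • (σ' • concat a) := e
    rw [mul_smul, e', e, mul_smul]
  inv_mem' {σ} h a := by
    obtain ⟨τ, hτ, e⟩ := h (σ⁻¹ • a)
    refine ⟨τ⁻¹, inv_mem hτ, ?_⟩
    have e : τ • (σ⁻¹ • concat a) = σ • (σ⁻¹ • concat a) := e
    rw [smul_inv_smul] at e
    rw [inv_smul_eq_iff, e]

/-- The automorphisms `σ` of `M` such that `a ≡ᴸ σ(a)` for the enumeration `a` of the whole set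
`Σ(M)`. -/
def lascarFixing (Sig : PartialType s) (M : Theory.ModelType.{u, v, w} T) :
    Subgroup (M ≃[L] M) where
  carrier := {σ | LongLascarEquiv (concat fun a : Sig.realisations M => a)
    (σ • concat fun a : Sig.realisations M => a)}
  one_mem' := by
    change LongLascarEquiv _ _
    rw [one_smul]
    exact LongLascarEquiv.refl _
  mul_mem' {σ σ'} h h' := by
    refine LongLascarEquiv.trans h' ?_
    rw [mul_smul]
    exact LongLascarEquiv.reindex (fun p : Sig.realisations M × I => (σ' • p.1, p.2))
      (prodMap_smul_injective σ') h
  inv_mem' {σ} h := by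
    have := (LongLascarEquiv.smul σ⁻¹ h).symm
    rwa [inv_smul_smul] at this

instance lascarFixingCard_normal (Sig : PartialType s) (M : Theory.ModelType.{u, v, w} T)
    (lam : Cardinal.{0}) : (lascarFixingCard Sig M lam).Normal := by
  refine ⟨fun σ h ρ a => ?_⟩
  obtain ⟨τ, hτ, e⟩ := h (ρ⁻¹ • a)
  have e : τ • (ρ⁻¹ • concat a) = σ • (ρ⁻¹ • concat a) := e
  refine ⟨ρ * τ * ρ⁻¹, (autf_normal M).conj_mem τ hτ ρ, ?_⟩
  rw [mul_smul, mul_smul, e, mul_smul, mul_smul]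

instance lascarFixing_normal (Sig : PartialType s) (M : Theory.ModelType.{u, v, w} T) :
    (lascarFixing Sig M).Normal := by
  refine ⟨fun σ h ρ => ?_⟩
  have h1 := LongLascarEquiv.smul ρ h
  have h2 := LongLascarEquiv.reindex (fun p : Sig.realisations M × I => (ρ⁻¹ • p.1, p.2))
    (prodMap_smul_injective ρ⁻¹) h1
  have e1 : (ρ • ρ⁻¹ • concat fun a : Sig.realisations M => a) =
      concat fun a : Sig.realisations M => a := smul_inv_smul _ _
  have e2 : (ρ * σ * ρ⁻¹) • (concat fun a : Sig.realisations M => a) =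
      ρ • σ • ρ⁻¹ • concat fun a : Sig.realisations M => a := by
    rw [mul_smul, mul_smul]
  change LongLascarEquiv _ _
  rw [e2]
  nth_rewrite 1 [← e1]
  exact h2

/-- `Autf_fix^lam(Σ(M))`, as a subgroup of `Aut(Σ(M))`. -/
def AutfFixCard (Sig : PartialType s) (M : Theory.ModelType.{u, v, w} T) (lam : Cardinal.{0}) :
    Subgroup (AutSigma Sig M) :=
  (lascarFixingCard Sig M lam).map (restrict Sig M).rangeRestrict

/-- `Autf_fix(Σ(M))`, as a subgroup of `Aut(Σ(M))`. -/
def AutfFix (Sig : PartialType s) (M : Theory.ModelType.{u, v, w} T) :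
    Subgroup (AutSigma Sig M) :=
  (lascarFixing Sig M).map (restrict Sig M).rangeRestrict

instance autfFixCard_normal (Sig : PartialType s) (M : Theory.ModelType.{u, v, w} T)
    (lam : Cardinal.{0}) : (AutfFixCard Sig M lam).Normal :=
  (lascarFixingCard_normal Sig M lam).map _ (restrict Sig M).rangeRestrict_surjective

instance autfFix_normal (Sig : PartialType s) (M : Theory.ModelType.{u, v, w} T) :
    (AutfFix Sig M).Normal :=
  (lascarFixing_normal Sig M).map _ (restrict Sig M).rangeRestrict_surjective

/-- The relativised Lascar group `Gal_L^{fix,lam}(Σ(M)) = Aut(Σ(M)) / Autf_fix^lam(Σ(M))`. -/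
abbrev GalFixCard (Sig : PartialType s) (M : Theory.ModelType.{u, v, w} T)
    (lam : Cardinal.{0}) : Type (max w y) :=
  AutSigma Sig M ⧸ AutfFixCard Sig M lam

/-- The relativised Lascar group `Gal_L^{fix}(Σ(M)) = Aut(Σ(M)) / Autf_fix(Σ(M))`. -/
abbrev GalFix (Sig : PartialType s) (M : Theory.ModelType.{u, v, w} T) : Type (max w y) :=
  AutSigma Sig M ⧸ AutfFix Sig M

/-- The class in `Gal_L^{fix,lam}(Σ(M))` of the restriction to `Σ(M)` of an automorphism. -/
def toGalFixCard (Sig : PartialType s) (M : Theory.ModelType.{u, v, w} T) (lam : Cardinal.{0}) :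
    (M ≃[L] M) →* GalFixCard Sig M lam :=
  (QuotientGroup.mk' (AutfFixCard Sig M lam)).comp (restrict Sig M).rangeRestrict

/-- The class in `Gal_L^{fix}(Σ(M))` of the restriction to `Σ(M)` of an automorphism. -/
def toGalFix (Sig : PartialType s) (M : Theory.ModelType.{u, v, w} T) :
    (M ≃[L] M) →* GalFix Sig M :=
  (QuotientGroup.mk' (AutfFix Sig M)).comp (restrict Sig M).rangeRestrict

end Groups

end RelLascar

open RelLascar

/-! The argument extends the classical proof that the Lascar group does not depend on the monster
model. Fix an elementary substructure of `M` of size at most `ℵ₀ + |L|`, enumerated by `m`, and a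
tuple `m'` of `M'` with the same type. Call automorphisms `f` of `M` and `f'` of `M'` partners
(`Corr`) if `(m, f m)` and `(m', f' m')` have the same type. By saturation and homogeneity every
automorphism has a partner on the other side (`IsMonster.exists_aut_sameTp`). Since `m'` enumerates
a model, two partners of the same `f` differ by an element of `Autf` (`Corr.mul_inv_mem_autf`). So
taking partners induces a homomorphism into every quotient of `Aut(M')` whose kernel contains
`Autf`, and it descends to an isomorphism of quotients as soon as partners lie in the two kernels
simultaneously (`exists_mulEquiv_of_corr`).

For the relativised groups this last condition is `Corr.mem_lascarFixingCard`. A tuple of at most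
countably many realisations of `Σ` is small, so it can be copied from `M'` to `M` over `m'` and `m`;
there `f` preserves its Lascar type, and this transfers back to `M'`. The transfer needs Lascar
equivalence to depend only on the type of a pair of tuples: a chain of steps found in any model can
be copied into a monster model (`LascarStep.lascarEquiv`, `lascarEquiv_of_reflTransGen`). An
elementary embedding `j` is accommodated by choosing `m' = j ∘ m`: automorphisms that commute with
`j` are then partners.

The group without a cardinal is the case `λ = ℵ₀` (`lascarFixing_eq`). If no chain of length `n`
joins the enumeration of `Σ(M)` to its image, compactness locates this failure in finitely many
coordinates. Over all `n` these involve only countably many realisations, and a countable tuple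
containing them all detects that the Lascar type of the enumeration is not preserved. -/

namespace RelLascar

/-! ## Tuples with the same type, in possibly different structures -/

section SameTp

variable {L : FirstOrder.Language.{u, v}}

variable (L) in
/-- `a` and `b` have the same type over `∅`, as tuples of real elements of two structures. -/
def SameTp {A : Type*} {M N : Type*} [L.Structure M] [L.Structure N] (a : A → M) (b : A → N) :
    Prop :=
  ∀ φ : L.Formula A, φ.Realize a ↔ φ.Realize b

section Basic

variable {A B : Type*} {M N P : Type*} [L.Structure M] [L.Structure N] [L.Structure P]

theorem SameTp.rfl {a : A → M} : SameTp L a a := fun _ => Iff.rfl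

theorem SameTp.symm {a : A → M} {b : A → N} (h : SameTp L a b) : SameTp L b a :=
  fun φ => (h φ).symm

theorem SameTp.trans {a : A → M} {b : A → N} {c : A → P} (h : SameTp L a b) (h' : SameTp L b c) :
    SameTp L a c :=
  fun φ => (h φ).trans (h' φ)

theorem SameTp.comp {a : A → M} {b : A → N} (h : SameTp L a b) (e : B → A) :
    SameTp L (a ∘ e) (b ∘ e) := by
  intro φ
  have := h (φ.relabel e)
  rwa [Formula.realize_relabel, Formula.realize_relabel] at this

theorem SameTp.inl {a : A → M} {b : B → M} {a' : A → N} {b' : B → N}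
    (h : SameTp L (Sum.elim a b) (Sum.elim a' b')) : SameTp L a a' :=
  h.comp Sum.inl

theorem SameTp.inr {a : A → M} {b : B → M} {a' : A → N} {b' : B → N}
    (h : SameTp L (Sum.elim a b) (Sum.elim a' b')) : SameTp L b b' :=
  h.comp Sum.inr

theorem sameTp_elementaryEmbedding (j : M ↪ₑ[L] N) (a : A → M) : SameTp L a (j ∘ a) :=
  fun φ => (j.map_formula φ a).symm

theorem sameTp_aut (f : M ≃[L] M) (a : A → M) : SameTp L a (f ∘ a) :=
  sameTp_elementaryEmbedding f.toElementaryEmbedding a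

theorem sameTp_of_imp {a : A → M} {b : A → N}
    (h : ∀ φ : L.Formula A, φ.Realize a → φ.Realize b) : SameTp L a b := by
  refine fun φ => ⟨h φ, fun hb => ?_⟩
  by_contra ha
  exact Formula.realize_not.1 (h φ.not (Formula.realize_not.2 ha)) hb

theorem SameTp.eq_iff {a : A → M} {b : A → N} (h : SameTp L a b) (i k : A) :
    a i = a k ↔ b i = b k := by
  have := h (Term.equal (Term.var i) (Term.var k))
  rwa [Formula.realize_equal, Formula.realize_equal] at this

/-- A formula has finitely many free variables. This makes unions of chains harmless in the Zorn
argument of `IsSaturated.exists_extend`. -/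
theorem sameTp_of_finset {a : A → M} {b : A → N}
    (h : ∀ F : Finset A, SameTp L (fun i : F => a i) (fun i : F => b i)) : SameTp L a b := by
  classical
  intro φ
  let ψ : L.Formula φ.freeVarFinset := BoundedFormula.restrictFreeVar φ id
  have h1 : ψ.Realize (fun i => a i) ↔ φ.Realize a :=
    BoundedFormula.realize_restrictFreeVar a fun _ => Eq.refl _
  have h2 : ψ.Realize (fun i => b i) ↔ φ.Realize b :=
    BoundedFormula.realize_restrictFreeVar b fun _ => Eq.refl _
  exact h1.symm.trans ((h _ ψ).trans h2)

/-- Satisfiability of a formula with parameters only depends on the type of the parameters. -/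
theorem SameTp.exists_realize [Nonempty N] {a : A → M} {c : A → N} (hac : SameTp L a c)
    (φ : L.Formula (A ⊕ B)) (h : ∃ b : B → M, φ.Realize (Sum.elim a b)) :
    ∃ b : B → N, φ.Realize (Sum.elim c b) := by
  classical
  obtain ⟨b, h⟩ := h
  let V := {q : B // Sum.inr q ∈ φ.freeVarFinset}
  have : Finite V := by
    refine Finite.of_injective (fun q : V => (⟨Sum.inr q.1, q.2⟩ : φ.freeVarFinset)) ?_
    intro q q' hq
    exact Subtype.ext (Sum.inr_injective (Subtype.ext_iff.1 hq))
  let f : φ.freeVarFinset → A ⊕ V := fun q =>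
    match q with
    | ⟨Sum.inl c, _⟩ => Sum.inl c
    | ⟨Sum.inr p, hp⟩ => Sum.inr ⟨p, hp⟩
  let ψ : L.Formula (A ⊕ V) := BoundedFormula.restrictFreeVar φ f
  have hM : (ψ.iExs V).Realize a := by
    rw [Formula.realize_iExs]
    refine ⟨fun q => b q.1, ?_⟩
    refine (BoundedFormula.realize_restrictFreeVar (Sum.elim a b) ?_).2 h
    rintro ⟨q | q, hq⟩ <;> rfl
  rw [hac, Formula.realize_iExs] at hM
  obtain ⟨d, hd⟩ := hM
  let b' : B → N := fun q =>
    if hq : Sum.inr q ∈ φ.freeVarFinset then d ⟨q, hq⟩ else Classical.arbitrary N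
  refine ⟨b', (BoundedFormula.realize_restrictFreeVar (Sum.elim c b') ?_).1 hd⟩
  rintro ⟨q | q, hq⟩
  · rfl
  · change d ⟨q, hq⟩ = if hq : Sum.inr q ∈ φ.freeVarFinset then d ⟨q, hq⟩ else Classical.arbitrary N
    rw [dif_pos (show Sum.inr q ∈ φ.freeVarFinset from hq)]

/-- Finite satisfiability of a set of formulas only depends on the type of the parameters. -/
theorem SameTp.exists_realize_family [Nonempty N] {a : A → M} {c : A → N} (hac : SameTp L a c)
    {ι : Type*} (F : ι → L.Formula (A ⊕ B)) (S : Finset ι)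
    (h : ∃ b : B → M, ∀ i ∈ S, (F i).Realize (Sum.elim a b)) :
    ∃ b : B → N, ∀ i ∈ S, (F i).Realize (Sum.elim c b) := by
  obtain ⟨b, h⟩ := h
  obtain ⟨b', h'⟩ := hac.exists_realize (Formula.iInf fun i : S => F i)
    ⟨b, by rw [Formula.realize_iInf]; exact fun i => h i i.2⟩
  rw [Formula.realize_iInf] at h'
  exact ⟨b', fun i hi => h' ⟨i, hi⟩⟩

end Basic

/-! ## Saturation and homogeneity for tuples -/

variable {M : Type w} [L.Structure M] {κ : Cardinal.{w}} {N : Type x} [L.Structure N]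

theorem mk_range_lt {A : Type y} (hA : Cardinal.lift.{w} #A < Cardinal.lift.{y} κ) (a : A → M) :
    #(Set.range a) < κ := by
  have := (mk_range_le_lift (f := a)).trans_lt hA
  rwa [Cardinal.lift_lt] at this

/-- The type of `n` over `c`, read over `a`, is finitely satisfiable because existential formulas
transfer between tuples of the same type. -/
theorem IsSaturated.exists_extend_one (hM : IsSaturated L κ M)
    {A : Type y} (hA : Cardinal.lift.{w} #A < Cardinal.lift.{y} κ) {a : A → M} {c : A → N}
    (h : SameTp L a c) (n : N) :
    ∃ m : M, SameTp L (Sum.elim a fun _ : Unit => m) (Sum.elim c fun _ : Unit => n) := by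
  choose g hg using fun e : Set.range a => e.2
  have hag : (fun e : Set.range a => (e : M)) = a ∘ g := funext fun e => (hg e).symm
  obtain ⟨m, hm⟩ := hM (Set.range a) (mk_range_lt hA a)
    {φ | φ.Realize (Sum.elim (c ∘ g) fun _ => n)} (by
      intro q hq
      have h1 : ((Formula.iInf fun φ : q => φ.1).iExs Unit).Realize (c ∘ g) := by
        rw [Formula.realize_iExs]
        refine ⟨fun _ => n, ?_⟩
        rw [Formula.realize_iInf]
        exact fun φ => hq φ.2
      rw [← (h.comp g) _, Formula.realize_iExs] at h1
      obtain ⟨m, h1⟩ := h1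
      rw [Formula.realize_iInf] at h1
      refine ⟨m (), fun φ hφ => ?_⟩
      rw [hag]
      exact h1 ⟨φ, hφ⟩)
  refine ⟨m, (sameTp_of_imp fun φ hφ => ?_).symm⟩
  have h1 := hm (φ.relabel (Sum.map (fun i => ⟨a i, i, rfl⟩) id)) (by
    change Formula.Realize _ _
    rw [Formula.realize_relabel]
    convert hφ using 1
    funext q
    rcases q with i | q
    -- The index chosen for the parameter `a i` need not be `i`; but `a` agrees at both indices,
    -- hence so does `c`.
    · exact (h.eq_iff _ _).1 (hg ⟨a i, i, rfl⟩)
    · rfl)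
  rw [Formula.realize_relabel] at h1
  convert h1 using 1
  funext q
  rcases q with i | q <;> rfl

/-- The one-element extension is iterated by Zorn's lemma. The model `N` need not be related to `M`
otherwise, so this is the tool for copying configurations between models. -/
theorem IsSaturated.exists_extend (hM : IsSaturated L κ M) (hκ : ℵ₀ ≤ κ)
    {A : Type y} (hA : Cardinal.lift.{w} #A < Cardinal.lift.{y} κ) {a : A → M} {c : A → N}
    (h : SameTp L a c) {B : Type z} (hB : Cardinal.lift.{w} #B < Cardinal.lift.{z} κ)
    (b : B → N) :
    ∃ b' : B → M, SameTp L (Sum.elim a b') (Sum.elim c b) := by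
  classical
  let val (G : Set (B × M)) : A ⊕ G → M := Sum.elim a fun g => g.1.2
  let arg (G : Set (B × M)) : A ⊕ G → N := Sum.elim c fun g => b g.1.1
  -- A pair `(i, m)` in `G` proposes `m` as the copy of `b i`. That `G` is single-valued is not
  -- imposed: it follows from the equality of types.
  obtain ⟨G, -, hG⟩ := zorn_subset_nonempty {G | SameTp L (val G) (arg G)} (by
    intro C hC hchain hne
    refine ⟨⋃₀ C, ?_, fun s hs => Set.subset_sUnion_of_mem hs⟩
    refine sameTp_of_finset fun F => ?_
    let E : Finset (B × M) := F.biUnion (Sum.elim (fun _ => ∅) fun g => {g.1})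
    obtain ⟨G, hGC, hEG⟩ := hchain.directedOn.exists_mem_subset_of_finite_of_subset_sUnion hne
      E.finite_toSet (by
        intro g hg
        obtain ⟨q, hq, hgq⟩ := Finset.mem_biUnion.1 hg
        rcases q with i | g'
        · simp at hgq
        · simp only [Sum.elim_inr, Finset.mem_singleton] at hgq
          rw [hgq]
          exact g'.2)
    have hmem : ∀ g : ⋃₀ C, Sum.inr g ∈ F → g.1 ∈ G := fun g hg => hEG (by
      refine Finset.mem_coe.2 (Finset.mem_biUnion.2 ⟨_, hg, ?_⟩)
      simp)
    let e : F → A ⊕ G := fun q =>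
      match q with
      | ⟨Sum.inl i, _⟩ => Sum.inl i
      | ⟨Sum.inr g, hg⟩ => Sum.inr ⟨g.1, hmem g hg⟩
    have h1 := (show SameTp L (val G) (arg G) from hC hGC).comp e
    convert h1 using 1
    · funext q
      rcases q with ⟨i | g, hq⟩ <;> rfl
    · funext q
      rcases q with ⟨i | g, hq⟩ <;> rfl) ∅ (by
    have h1 := h.comp (Sum.elim id (fun g : (∅ : Set (B × M)) => g.2.elim) : _ → A)
    change SameTp L _ _
    convert h1 using 1
    · funext q
      rcases q with i | g
      · rfl
      · exact g.2.elim
    · funext q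
      rcases q with i | g
      · rfl
      · exact g.2.elim)
  have hGP : SameTp L (val G) (arg G) := hG.prop
  -- Two values proposed for the same index are equal, so `G` injects into `B` and the parameters
  -- stay small enough for one more extension.
  have hGcard : Cardinal.lift.{w} #(A ⊕ G) < Cardinal.lift.{max y z w} κ := by
    have hinj : Function.Injective fun g : G => g.1.1 := by
      intro g g' hgg
      have h1 : b g.1.1 = b g'.1.1 := congrArg b hgg
      have h2 := (hGP.eq_iff (Sum.inr g) (Sum.inr g')).2 h1
      exact Subtype.ext (Prod.ext hgg h2)
    have h1 := mk_le_of_injective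
      (f := fun g : G => ULift.up.{w} g.1.1) (fun g g' hgg => hinj (ULift.up_injective hgg))
    rw [mk_uLift] at h1
    rw [mk_sum, Cardinal.lift_add]
    refine add_lt_of_lt (aleph0_le_lift.2 hκ) ?_ ?_
    · have := Cardinal.lift_lt.{_, max z w}.2 hA
      simpa using this
    · refine (Cardinal.lift_le.2 (Cardinal.lift_le.2 h1)).trans_lt ?_
      have := Cardinal.lift_lt.{_, max y w}.2 hB
      simpa using this
  have key : ∀ i : B, ∃ m : M, (i, m) ∈ G := by
    intro i
    obtain ⟨m, hm⟩ := hM.exists_extend_one hGcard hGP (b i)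
    refine ⟨m, hG.le_of_ge (y := insert (i, m) G) ?_ (Set.subset_insert _ _) (Set.mem_insert _ _)⟩
    let e : A ⊕ (insert (i, m) G : Set (B × M)) → (A ⊕ G) ⊕ Unit :=
      Sum.elim (fun k => Sum.inl (Sum.inl k))
        (fun g => if hg : g.1 ∈ G then Sum.inl (Sum.inr ⟨g.1, hg⟩) else Sum.inr ())
    have h1 := hm.comp e
    change SameTp L _ _
    convert h1 using 1
    · funext q
      rcases q with k | g
      · rfl
      · by_cases hg : g.1 ∈ G
        · simp [e, val, hg]
        · have := g.2.resolve_right hg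
          simp [e, val, this, show (i, m) ∉ G from this ▸ hg]
    · funext q
      rcases q with k | g
      · rfl
      · by_cases hg : g.1 ∈ G
        · simp [e, arg, hg]
        · have := g.2.resolve_right hg
          simp [e, arg, this, show (i, m) ∉ G from this ▸ hg]
  choose b' hb' using key
  refine ⟨b', ?_⟩
  have h1 := hGP.comp (Sum.map id fun i => ⟨(i, b' i), hb' i⟩)
  convert h1 using 1
  · funext q
    rcases q with k | g <;> rfl
  · funext q
    rcases q with k | g <;> rfl

theorem IsStronglyHomogeneous.exists_aut (hM : IsStronglyHomogeneous L κ M)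
    {A : Type y} (hA : Cardinal.lift.{w} #A < Cardinal.lift.{y} κ) {a b : A → M}
    (h : SameTp L a b) : ∃ σ : M ≃[L] M, σ ∘ a = b := by
  choose g hg using fun e : Set.range a => e.2
  have hag : (fun e : Set.range a => (e : M)) = a ∘ g := funext fun e => (hg e).symm
  obtain ⟨σ, hσ⟩ := hM (Set.range a) (mk_range_lt hA a) (b ∘ g) (by
    rw [hag]
    exact h.comp g)
  refine ⟨σ, funext fun i => ?_⟩
  rw [Function.comp_apply, hσ ⟨a i, i, rfl⟩]
  exact (h.eq_iff _ _).1 (hg ⟨a i, i, rfl⟩)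

end SameTp

/-! ### Compactness and realisation of small types in a saturated model -/

section Realise

variable {L : FirstOrder.Language.{u, v}} {T : L.Theory}

/-- Compactness for a family of formulas. -/
theorem exists_realize_family {A : Type z} {ι : Type*} (F : ι → L.Formula A)
    (h : ∀ S : Finset ι, ∃ (M : Theory.ModelType.{u, v, x} T) (a : A → M),
      ∀ i ∈ S, (F i).Realize a) :
    ∃ (N : Theory.ModelType.{u, v, max u v z} T) (a : A → N), ∀ i, (F i).Realize a := by
  classical
  obtain ⟨N, a, ha⟩ := exists_realize_of_finite.{u, v, x, z} (T := T) (Set.range F) (by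
    intro q hq
    rw [← Set.image_univ] at hq
    obtain ⟨S, -, rfl⟩ := Finset.subset_set_image_iff.1 hq
    obtain ⟨M, a, ha⟩ := h S
    refine ⟨M, a, fun φ hφ => ?_⟩
    obtain ⟨i, hi, rfl⟩ := Finset.mem_image.1 hφ
    exact ha i hi)
  exact ⟨N, a, fun i => ha _ ⟨i, rfl⟩⟩

theorem sameTp_of_isComplete (hT : T.IsComplete) {A : Type*} [IsEmpty A]
    (M : Theory.ModelType.{u, v, w} T) (N : Theory.ModelType.{u, v, x} T) (a : A → M) (b : A → N) :
    SameTp L a b := by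
  intro φ
  let ψ : L.Sentence := φ.relabel (isEmptyElim : A → Empty)
  have h1 := (hT.realize_sentence_iff ψ M).trans (hT.realize_sentence_iff ψ N).symm
  simp only [ψ, Sentence.Realize, Formula.realize_relabel] at h1
  convert h1 using 2

variable {κ : Cardinal.{w}} {M : Theory.ModelType.{u, v, w} T}

/-- A family of formulas over a small tuple that is finitely satisfiable over a tuple of the same
type is realised in a saturated model. -/
theorem IsSaturated.exists_realize_family (hM : IsSaturated L κ M) (hκ : ℵ₀ ≤ κ)
    {A : Type y} (hA : Cardinal.lift.{w} #A < Cardinal.lift.{y} κ)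
    {B : Type z} (hB : Cardinal.lift.{w} #B < Cardinal.lift.{z} κ)
    {N : Theory.ModelType.{u, v, x} T} {a : A → M} {c : A → N} (h : SameTp L a c)
    {ι : Type*} (F : ι → L.Formula (A ⊕ B))
    (hF : ∀ S : Finset ι, ∃ b : B → N, ∀ i ∈ S, (F i).Realize (Sum.elim c b)) :
    ∃ b : B → M, ∀ i, (F i).Realize (Sum.elim a b) := by
  -- Adding all formulas true of `c` forces the parameters in the model given by compactness to have
  -- the type of `c`, hence of `a`.
  let F' : ι ⊕ {φ : L.Formula A // φ.Realize c} → L.Formula (A ⊕ B) :=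
    Sum.elim F fun φ => φ.1.relabel Sum.inl
  obtain ⟨P, d, hd⟩ := RelLascar.exists_realize_family (T := T) F' (by
    intro S
    obtain ⟨b, hb⟩ := hF S.toLeft
    refine ⟨N, Sum.elim c b, ?_⟩
    rintro (i | φ) hi
    · exact hb i (Finset.mem_toLeft.2 hi)
    · change Formula.Realize (φ.1.relabel Sum.inl) _
      rw [Formula.realize_relabel]
      exact φ.2)
  have hcd : SameTp L c (d ∘ Sum.inl) := sameTp_of_imp fun φ hφ => by
    have := hd (Sum.inr ⟨φ, hφ⟩)
    change Formula.Realize (φ.relabel Sum.inl) _ at this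
    rwa [Formula.realize_relabel] at this
  obtain ⟨b, hb⟩ := hM.exists_extend hκ hA (h.trans hcd) hB (d ∘ Sum.inr)
  refine ⟨b, fun i => (hb _).2 ?_⟩
  rw [Sum.elim_comp_inl_inr]
  exact hd (Sum.inl i)

end Realise

/-! ## Small index types -/

section Small

/-- The type `A` has fewer than `κ` elements. -/
abbrev IsSmallFor (κ : Cardinal.{w}) (A : Type y) : Prop :=
  Cardinal.lift.{w} #A < Cardinal.lift.{y} κ

variable {κ : Cardinal.{w}} {A : Type y} {B : Type z}

theorem isSmallFor_iff_lift : IsSmallFor κ A ↔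
    Cardinal.lift.{max w z} #A < Cardinal.lift.{max y z} κ := by
  rw [IsSmallFor, ← Cardinal.lift_lt.{max y w, z}, Cardinal.lift_lift, Cardinal.lift_lift]

theorem IsSmallFor.of_injective (hB : IsSmallFor κ B) (f : A → B) (hf : Function.Injective f) :
    IsSmallFor κ A := by
  have h1 : Cardinal.lift.{max w z} #A ≤ Cardinal.lift.{max w y} #B := by
    have := Cardinal.lift_mk_le_lift_mk_of_injective hf
    simpa using Cardinal.lift_le.{w}.2 this
  exact isSmallFor_iff_lift.{w, y, z}.2 (h1.trans_lt (isSmallFor_iff_lift.{w, z, y}.1 hB))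

theorem IsSmallFor.sum (hκ : ℵ₀ ≤ κ) (hA : IsSmallFor κ A) (hB : IsSmallFor κ B) :
    IsSmallFor κ (A ⊕ B) := by
  rw [IsSmallFor, mk_sum, Cardinal.lift_add, Cardinal.lift_lift, Cardinal.lift_lift]
  exact add_lt_of_lt (aleph0_le_lift.2 hκ) (isSmallFor_iff_lift.{w, y, z}.1 hA)
    (isSmallFor_iff_lift.{w, z, y}.1 hB)

theorem IsSmallFor.prod (hκ : ℵ₀ ≤ κ) (hA : IsSmallFor κ A) (hB : IsSmallFor κ B) :
    IsSmallFor κ (A × B) := by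
  rw [IsSmallFor, mk_prod, Cardinal.lift_mul, Cardinal.lift_lift, Cardinal.lift_lift]
  exact mul_lt_of_lt (aleph0_le_lift.2 hκ) (isSmallFor_iff_lift.{w, y, z}.1 hA)
    (isSmallFor_iff_lift.{w, z, y}.1 hB)

theorem isSmallFor_of_countable (hκ : ℵ₀ < κ) [Countable A] : IsSmallFor κ A := by
  have h1 : Cardinal.lift.{w} #A ≤ ℵ₀ := by simp
  exact h1.trans_lt (by simpa using hκ)

theorem IsSmallFor.sigma_fin (hκ : ℵ₀ < κ) (hA : IsSmallFor κ A) (n : A → ℕ) :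
    IsSmallFor κ (Σ i, Fin (n i)) := by
  refine (hA.prod hκ.le (isSmallFor_of_countable (A := ℕ) hκ)).of_injective
    (fun p => (p.1, (p.2 : ℕ))) ?_
  rintro ⟨i, k⟩ ⟨i', k'⟩ h
  obtain ⟨h1, h2⟩ := Prod.mk.inj h
  dsimp only at h1 h2
  subst h1
  rw [Fin.ext h2]

end Small

/-! ## Small elementary substructures -/

section SmallModels

variable {L : FirstOrder.Language.{u, v}}

theorem exists_elementarySubstructure_card_le (M : Type w) [L.Structure M] :
    ∃ M₀ : L.ElementarySubstructure M,
      Cardinal.lift.{max u v} #M₀ ≤ max ℵ₀ (Cardinal.lift.{w} L.card) := by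
  have hl : Cardinal.lift.{w} (max ℵ₀ L.card) = max ℵ₀ (Cardinal.lift.{w} L.card) := by
    rw [Cardinal.lift_max, lift_aleph0]
  rcases le_total (Cardinal.lift.{w} (max ℵ₀ L.card)) (Cardinal.lift.{max u v} #M) with h | h
  · obtain ⟨M₀, -, hM₀⟩ := exists_elementarySubstructure_card_eq L (∅ : Set M) (max ℵ₀ L.card)
      (le_max_left _ _) (by simp) (by
        simp) h
    exact ⟨M₀, (hM₀.trans hl).le⟩
  -- The model may be smaller than the Löwenheim–Skolem bound, for instance finite; then it serves
  -- itself.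
  · refine ⟨⊤, le_trans (Cardinal.lift_le.2 ?_) (h.trans hl.le)⟩
    exact mk_le_of_injective (f := Subtype.val) Subtype.val_injective

theorem IsMonster.isSmallFor {κ : Cardinal.{w}} {M : Type w} [L.Structure M]
    (hM : IsMonster L κ M) {A : Type x}
    (hA : Cardinal.lift.{max u v} #A ≤ max ℵ₀ (Cardinal.lift.{x} L.card)) : IsSmallFor κ A := by
  rw [isSmallFor_iff_lift.{w, x, max u v}]
  have h1 := Cardinal.lift_le.{w}.2 hA
  rw [Cardinal.lift_lift] at h1
  refine h1.trans_lt ?_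
  rw [Cardinal.lift_max, max_lt_iff]
  constructor
  · simpa using hM.aleph0_lt
  · have := Cardinal.lift_lt.{_, x}.2 hM.card_language_lt
    simpa using this

theorem exists_elementarySubstructure_coe_eq_range {M : Type w} [L.Structure M] {N : Type x}
    [L.Structure N] (M₀ : L.ElementarySubstructure M) {n : M₀ → N}
    (h : SameTp L (fun c : M₀ => (c : M)) n) :
    ∃ N₀ : L.ElementarySubstructure N, (N₀ : Set N) = Set.range n := by
  let k : M₀ ↪ₑ[L] N := ⟨n, fun l φ c => by
    rw [← (h.comp c) φ]
    exact M₀.subtype.map_formula φ c⟩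
  refine ⟨mapSubstructure L k ⊤, Set.ext fun b => ?_⟩
  refine (mem_mapSubstructure k ⊤ b).trans ?_
  simp only [ElementarySubstructure.mem_top, true_and]
  exact Iff.rfl

/-- A tuple enumerating an elementary substructure can be approximated in every model. -/
theorem exists_realize_of_isComplete {T : L.Theory} (hT : T.IsComplete)
    (M : Theory.ModelType.{u, v, w} T) (N : Theory.ModelType.{u, v, x} T)
    (N₀ : L.ElementarySubstructure N) {B : Type z} (m : B → M)
    (S : Finset {φ : L.Formula B // φ.Realize m}) :
    ∃ n : B → N₀, ∀ φ ∈ S, φ.1.Realize fun b => (n b : N) := by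
  have : Nonempty N₀ := N₀.elementarilyEquivalent.nonempty_iff.2 inferInstance
  -- By completeness the empty tuple has the same type in `M` and in `N₀`, so finite parts of the
  -- type of `m` are satisfied in `N₀` itself.
  have h0 : SameTp L (Empty.elim : Empty → M) (Empty.elim : Empty → N₀) := by
    refine (sameTp_of_isComplete hT M N _ (fun e => e.elim)).trans ?_
    refine SameTp.symm ?_
    have := sameTp_elementaryEmbedding N₀.subtype (Empty.elim : Empty → N₀)
    convert this using 1
  obtain ⟨n, hn⟩ := h0.exists_realize_family
    (fun φ : {φ : L.Formula B // φ.Realize m} => φ.1.relabel (Sum.inr : B → Empty ⊕ B)) S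
    ⟨m, fun φ _ => by
      rw [Formula.realize_relabel]
      exact φ.2⟩
  refine ⟨n, fun φ hφ => ?_⟩
  have h1 := hn φ hφ
  rw [Formula.realize_relabel] at h1
  exact (N₀.subtype.map_formula φ.1 n).2 h1

end SmallModels

/-! ## Chains of real tuples -/

section RealStep

variable {L : FirstOrder.Language.{u, v}} {M : Type w} [L.Structure M] {A : Type y}

variable (L) in
/-- The real tuples `c` and `d` have the same type over some elementary substructure. -/
def RealStep (c d : A → M) : Prop :=
  ∃ M₀ : L.ElementarySubstructure M,
    SameTp L (Sum.elim (fun e : (M₀ : Set M) => (e : M)) c)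
      (Sum.elim (fun e : (M₀ : Set M) => (e : M)) d)

theorem RealStep.refl (c : A → M) : RealStep L c c :=
  ⟨⊤, SameTp.rfl⟩

theorem RealStep.symm {c d : A → M} (h : RealStep L c d) : RealStep L d c :=
  h.imp fun _ => SameTp.symm

/-- A generator fixing a model gives one step, products concatenate chains and inverses reverse
them. The length of `r` is unrestricted, so one `τ` also moves an enumeration of all of `Σ(M)` along
a chain. -/
theorem reflTransGen_realStep_of_mem_autf {τ : M ≃[L] M} (hτ : τ ∈ Autf L M) (r : A → M) :
    Relation.ReflTransGen (RealStep L) r (τ ∘ r) := by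
  induction hτ using Subgroup.closure_induction generalizing r with
  | mem f hf =>
    obtain ⟨M₀, hf⟩ := hf
    refine Relation.ReflTransGen.single ⟨M₀, ?_⟩
    have := sameTp_aut f (Sum.elim (fun c : (M₀ : Set M) => (c : M)) r)
    convert this using 1
    funext q
    rcases q with q | q
    · exact (hf q q.2).symm
    · rfl
  | one => exact Relation.ReflTransGen.refl
  | mul f g _ _ hf hg => exact (hg r).trans (hf (g ∘ r))
  | inv f _ hf =>
    have h1 := hf (f.symm ∘ r)
    have h2 : f ∘ f.symm ∘ r = r := funext fun i => f.apply_symm_apply (r i)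
    rw [h2] at h1
    exact Relation.ReflTransGen.mono (fun _ _ => RealStep.symm) _ _
      (Relation.ReflTransGen.swap _ _ h1)

/-- Padding with constant steps indexes every chain by `ℕ`, the uniform shape that the compactness
argument for chains requires. -/
theorem exists_seq_of_reflTransGen {c d : A → M} (h : Relation.ReflTransGen (RealStep L) c d) :
    ∃ (f : ℕ → A → M) (n : ℕ), f 0 = c ∧ f n = d ∧ ∀ k, RealStep L (f k) (f (k + 1)) := by
  induction h using Relation.ReflTransGen.head_induction_on with
  | refl => exact ⟨fun _ => d, 0, rfl, rfl, fun _ => RealStep.refl d⟩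
  | @head a b hab _ ih =>
    obtain ⟨f, n, rfl, hn, hf⟩ := ih
    refine ⟨fun k => Nat.casesOn k a f, n + 1, rfl, hn, fun k => ?_⟩
    cases k with
    | zero => exact hab
    | succ k => exact hf k

end RealStep

/-! ## Lascar equivalence and types of representatives -/

section Lascar

variable {L : FirstOrder.Language.{u, v}} {T : L.Theory} {I : Type y} {s : I → EqSort T}

/-- The tuple of `M^eq` represented by a real tuple. -/
def clsTuple {M : Theory.ModelType.{u, v, w} T} (r : RepVar s → M) : EqTuple s M :=
  fun i => (s i).cls fun k => r ⟨i, k⟩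

theorem isRep_iff {M : Theory.ModelType.{u, v, w} T} {r : RepVar s → M} {a : EqTuple s M} :
    IsRep r a ↔ clsTuple r = a :=
  funext_iff.symm

theorem clsTuple_eq_iff {M : Theory.ModelType.{u, v, w} T} {r r' : RepVar s → M} :
    clsTuple r = clsTuple r' ↔
      ∀ i, (s i).rel.Realize (Sum.elim (fun k => r ⟨i, k⟩) fun k => r' ⟨i, k⟩) :=
  funext_iff.trans (forall_congr' fun _ => Quotient.eq (r := EqSort.setoid _ _))

theorem smul_clsTuple {M : Theory.ModelType.{u, v, w} T} (f : M ≃[L] M) (r : RepVar s → M) :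
    f • clsTuple r = clsTuple (f ∘ r) :=
  rfl

theorem mapTuple_clsTuple {M : Theory.ModelType.{u, v, w} T} {N : Theory.ModelType.{u, v, x} T}
    (j : M ↪ₑ[L] N) (r : RepVar s → M) : mapTuple j (clsTuple r) = clsTuple (j ∘ r) :=
  rfl

theorem exists_clsTuple {M : Theory.ModelType.{u, v, w} T} (a : EqTuple s M) :
    ∃ r : RepVar s → M, clsTuple r = a :=
  (exists_isRep a).imp fun _ => isRep_iff.1

theorem LascarStep.refl {M : Theory.ModelType.{u, v, w} T} (a : EqTuple s M) : LascarStep a a :=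
  ⟨⊤, fun _ => Iff.rfl⟩

theorem LascarEquiv.trans {M : Theory.ModelType.{u, v, w} T} {a b c : EqTuple s M}
    (h : LascarEquiv a b) (h' : LascarEquiv b c) : LascarEquiv a c := by
  obtain ⟨τ, hτ, rfl⟩ := h
  obtain ⟨τ', hτ', rfl⟩ := h'
  exact ⟨τ' * τ, mul_mem hτ' hτ, mul_smul _ _ _⟩

/-- Satisfaction of a formula with parameters by a tuple of `M^eq` only depends on the type of
representatives of the tuple. -/
theorem SameTp.exists_isRep_realize {P : Type z} {M : Theory.ModelType.{u, v, w} T}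
    {N : Theory.ModelType.{u, v, x} T} {c : P → M} {c' : P → N} {r₀ : RepVar s → M}
    {r₀' : RepVar s → N} (h : SameTp L (Sum.elim c r₀) (Sum.elim c' r₀'))
    (φ : L.Formula (P ⊕ RepVar s))
    (hr : ∃ r : RepVar s → M, IsRep r (clsTuple r₀) ∧ φ.Realize (Sum.elim c r)) :
    ∃ r : RepVar s → N, IsRep r (clsTuple r₀') ∧ φ.Realize (Sum.elim c' r) := by
  classical
  obtain ⟨r, hr, hφ⟩ := hr
  -- A single formula can require equivalence with the given representatives only at the finitely
  -- many coordinates occurring in `φ`. Elsewhere the given representatives are kept.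
  let I₀ : Finset I := φ.freeVarFinset.biUnion
    (Sum.elim (fun _ => ∅) (fun p : RepVar s => {p.1}))
  have mem_I₀ : ∀ p : RepVar s, Sum.inr p ∈ φ.freeVarFinset → p.1 ∈ I₀ := by
    intro p hp
    refine Finset.mem_biUnion.2 ⟨_, hp, ?_⟩
    simp
  let e : (i : I) → Fin (s i).arity ⊕ Fin (s i).arity → (P ⊕ RepVar s) ⊕ RepVar s := fun i =>
    Sum.elim (fun k => Sum.inr ⟨i, k⟩) (fun k => Sum.inl (Sum.inr ⟨i, k⟩))
  let ψ : L.Formula ((P ⊕ RepVar s) ⊕ RepVar s) :=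
    (φ.relabel (Sum.map Sum.inl id)) ⊓ Formula.iInf fun i : I₀ => (s i).rel.relabel (e i)
  obtain ⟨b, hb⟩ := h.exists_realize ψ ⟨r, by
    rw [Formula.realize_inf, Formula.realize_iInf, Formula.realize_relabel]
    constructor
    · convert hφ using 1
      funext q
      cases q <;> rfl
    · rintro ⟨i, hi⟩
      rw [Formula.realize_relabel]
      have h1 := clsTuple_eq_iff.1 (isRep_iff.1 hr) i
      convert h1 using 1
      funext q
      cases q <;> rfl⟩
  rw [Formula.realize_inf, Formula.realize_iInf, Formula.realize_relabel] at hb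
  obtain ⟨hb₁, hb₂⟩ := hb
  let r' : RepVar s → N := fun p => if p.1 ∈ I₀ then b p else r₀' p
  refine ⟨r', fun i => ?_, ?_⟩
  · by_cases hi : i ∈ I₀
    · have h1 := hb₂ ⟨i, hi⟩
      rw [Formula.realize_relabel] at h1
      have h2 : (s i).rel.Realize (Sum.elim (fun k => b ⟨i, k⟩) fun k => r₀' ⟨i, k⟩) := by
        convert h1 using 1
        funext q
        cases q <;> rfl
      have h3 : (fun k => r' ⟨i, k⟩) = fun k => b ⟨i, k⟩ := by
        funext k
        exact if_pos hi
      rw [h3]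
      exact Quotient.sound h2
    · have h3 : (fun k => r' ⟨i, k⟩) = fun k => r₀' ⟨i, k⟩ := by
        funext k
        exact if_neg hi
      rw [h3]
      rfl
  · refine (realize_congr_of_freeVar φ ?_).1 hb₁
    rintro (q | q) hq
    · rfl
    · exact (if_pos (mem_I₀ q hq)).symm

/-- Membership in the set of realisations of `Σ` only depends on the type of representatives. -/
theorem SameTp.mem_realisations {M : Theory.ModelType.{u, v, w} T}
    {N : Theory.ModelType.{u, v, x} T} {r : RepVar s → M} {r' : RepVar s → N} (h : SameTp L r r')
    {Sig : PartialType s} (hr : clsTuple r ∈ Sig.realisations M) :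
    clsTuple r' ∈ Sig.realisations N := by
  intro φ hφ
  have h1 : SameTp L (Sum.elim (Empty.elim : Empty → M) r)
      (Sum.elim (Empty.elim : Empty → N) r') := by
    have := h.comp (Sum.elim Empty.elim id : Empty ⊕ RepVar s → RepVar s)
    convert this using 1
    · funext q
      rcases q with q | q
      · exact q.elim
      · rfl
    · funext q
      rcases q with q | q
      · exact q.elim
      · rfl
  obtain ⟨t, ht, hφt⟩ := hr φ hφ
  obtain ⟨t', ht', hφt'⟩ := h1.exists_isRep_realize (φ.relabel Sum.inr)
    ⟨t, ht, by rwa [Formula.realize_relabel]⟩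
  rw [Formula.realize_relabel] at hφt'
  exact ⟨t', ht', hφt'⟩

theorem sameType_of_sameTp {M : Theory.ModelType.{u, v, w} T} {A : Set M} {r r' : RepVar s → M}
    (h : SameTp L (Sum.elim (fun c : A => (c : M)) r) (Sum.elim (fun c : A => (c : M)) r')) :
    SameType A (clsTuple r) (clsTuple r') :=
  fun φ => ⟨h.exists_isRep_realize φ, h.symm.exists_isRep_realize φ⟩

/-- Conjugacy under `Autf(M)` implies the existence of a chain of Lascar steps. -/
theorem LascarEquiv.reflTransGen {M : Theory.ModelType.{u, v, w} T} {a b : EqTuple s M}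
    (h : LascarEquiv a b) : Relation.ReflTransGen LascarStep a b := by
  obtain ⟨τ, hτ, rfl⟩ := h
  obtain ⟨r, rfl⟩ := exists_clsTuple a
  refine Relation.ReflTransGen.lift clsTuple (fun c d hcd => ?_) _ _
    (reflTransGen_realStep_of_mem_autf hτ r)
  obtain ⟨M₀, hcd⟩ := hcd
  exact ⟨M₀, sameType_of_sameTp hcd⟩

variable {M : Theory.ModelType.{u, v, w} T} {κ : Cardinal.{w}}

/-- The model `N₀` witnessing the step may be too large to copy into `M`. Its role is taken by a
copy of a small `M₀ ≼ M`, since finite parts of the type of `M₀` are satisfied inside `N₀`. Over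
this copy `t` has the same type as some representative of the class of `t'`, and homogeneity gives
an automorphism that fixes the copy and carries one to the other. -/
theorem LascarStep.lascarEquiv (hT : T.IsComplete) (hM : IsMonster L κ M) (hI : IsSmallFor κ I)
    {N : Theory.ModelType.{u, v, x} T} {r r' : RepVar s → N}
    (h : LascarStep (clsTuple r) (clsTuple r')) {t t' : RepVar s → M}
    (ht : SameTp L (Sum.elim t t') (Sum.elim r r')) :
    LascarEquiv (clsTuple t) (clsTuple t') := by
  classical
  obtain ⟨N₀, h⟩ := h
  obtain ⟨M₀, hM₀⟩ := exists_elementarySubstructure_card_le (L := L) M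
  have hκ := hM.aleph0_lt
  have hB : IsSmallFor κ M₀ := hM.isSmallFor hM₀
  have hR : IsSmallFor κ (RepVar s) := hI.sigma_fin hκ _
  let m : M₀ → M := fun c => c
  let eu : M₀ ⊕ RepVar s → (RepVar s ⊕ RepVar s) ⊕ (M₀ ⊕ RepVar s) :=
    Sum.elim (fun b => Sum.inr (Sum.inl b)) (fun p => Sum.inl (Sum.inl p))
  -- The unknowns are a copy of `M₀` and a new representative of the class of `t'`. The three
  -- families say that the copy has the type of `m`, that the representative is equivalent to `t'`,
  -- and that it has the same type as `t` over the copy.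
  let F : {φ : L.Formula M₀ // φ.Realize m} ⊕ (I ⊕ L.Formula (M₀ ⊕ RepVar s)) →
      L.Formula ((RepVar s ⊕ RepVar s) ⊕ (M₀ ⊕ RepVar s)) :=
    Sum.elim (fun φ => φ.1.relabel fun b => Sum.inr (Sum.inl b)) <|
      Sum.elim (fun i => (s i).rel.relabel
          (Sum.elim (fun k => Sum.inr (Sum.inr ⟨i, k⟩)) (fun k => Sum.inl (Sum.inr ⟨i, k⟩))))
        fun φ => (φ.relabel eu).iff (φ.relabel Sum.inr)
  obtain ⟨d, hd⟩ := hM.saturated.exists_realize_family hκ.le (hR.sum hκ.le hR) (hB.sum hκ.le hR)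
    ht F (by
      intro S
      obtain ⟨n, hn⟩ := exists_realize_of_isComplete hT M N N₀ m S.toLeft
      let S' := S.toRight.toRight
      let n' : M₀ → (N₀ : Set N) := n
      -- Each relevant formula or its negation, whichever holds of `r` over `n`. Equality of types
      -- over `N₀` then yields a representative of the class of `r'` with the same description.
      let G : S' → L.Formula ((N₀ : Set N) ⊕ RepVar s) := fun φ =>
        if φ.1.Realize (Sum.elim (fun b => (n b : N)) r) then φ.1.relabel (Sum.map n' id)
        else (φ.1.relabel (Sum.map n' id)).not
      have hG : ∀ (φ : S') (t : RepVar s → N),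
          (G φ).Realize (Sum.elim (fun c : (N₀ : Set N) => (c : N)) t) ↔
          (φ.1.Realize (Sum.elim (fun b => (n b : N)) r) ↔
            φ.1.Realize (Sum.elim (fun b => (n b : N)) t)) := by
        intro φ t
        have e1 : (φ.1.relabel (Sum.map n' id)).Realize
            (Sum.elim (fun c : (N₀ : Set N) => (c : N)) t) ↔
            φ.1.Realize (Sum.elim (fun b => (n b : N)) t) := by
          rw [Formula.realize_relabel, Sum.elim_comp_map]
          exact Iff.rfl
        by_cases hφ : φ.1.Realize (Sum.elim (fun b => (n b : N)) r)
        · simp only [G, if_pos hφ, e1, hφ, true_iff]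
        · simp only [G, if_neg hφ, Formula.realize_not, e1, hφ, false_iff]
      obtain ⟨t, ht, hGt⟩ := (h (Formula.iInf G)).1 ⟨r, isRep_iff.2 rfl, by
        rw [Formula.realize_iInf]
        exact fun φ => (hG φ r).2 Iff.rfl⟩
      rw [Formula.realize_iInf] at hGt
      refine ⟨Sum.elim (fun b => (n b : N)) t, ?_⟩
      rintro (φ | i | φ) hi
      · change Formula.Realize (φ.1.relabel _) _
        rw [Formula.realize_relabel]
        exact hn φ (Finset.mem_toLeft.2 hi)
      · change Formula.Realize ((s i).rel.relabel _) _
        rw [Formula.realize_relabel]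
        convert clsTuple_eq_iff.1 (isRep_iff.1 ht) i using 1
        funext q
        cases q <;> rfl
      · change Formula.Realize ((φ.relabel _).iff (φ.relabel _)) _
        rw [Formula.realize_iff, Formula.realize_relabel, Formula.realize_relabel]
        convert (hG ⟨φ, by simpa [S'] using hi⟩ t).1 (hGt _) using 2 <;>
        · funext q
          cases q <;> rfl)
  have h1 : SameTp L m (d ∘ Sum.inl) := sameTp_of_imp fun φ hφ => by
    have := hd (Sum.inl ⟨φ, hφ⟩)
    change Formula.Realize (φ.relabel _) _ at this
    rwa [Formula.realize_relabel] at this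
  have h2 : clsTuple (d ∘ Sum.inr) = clsTuple t' := clsTuple_eq_iff.2 fun i => by
    have := hd (Sum.inr (Sum.inl i))
    change Formula.Realize ((s i).rel.relabel _) _ at this
    rw [Formula.realize_relabel] at this
    convert this using 1
    funext q
    cases q <;> rfl
  have h3 : SameTp L (Sum.elim (d ∘ Sum.inl) t) d := fun φ => by
    have := hd (Sum.inr (Sum.inr φ))
    change Formula.Realize ((φ.relabel _).iff (φ.relabel _)) _ at this
    rw [Formula.realize_iff, Formula.realize_relabel, Formula.realize_relabel] at this
    convert this using 2 <;>
    · funext q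
      cases q <;> rfl
  obtain ⟨M₁, hM₁⟩ := exists_elementarySubstructure_coe_eq_range M₀ h1
  obtain ⟨τ, hτ⟩ := hM.stronglyHomogeneous.exists_aut (hB.sum hκ.le hR) h3
  refine ⟨τ, Subgroup.subset_closure ⟨M₁, fun c hc => ?_⟩, ?_⟩
  · have hc : c ∈ (M₁ : Set M) := hc
    rw [hM₁] at hc
    obtain ⟨b, rfl⟩ := hc
    exact congrFun hτ (Sum.inl b)
  · rw [smul_clsTuple, ← h2, ← hτ]
    rfl

/-- A chain of Lascar steps in some model can be copied into a monster model. -/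
theorem lascarEquiv_of_reflTransGen (hT : T.IsComplete) (hM : IsMonster L κ M)
    (hI : IsSmallFor κ I) {N : Theory.ModelType.{u, v, x} T} {r r' : RepVar s → N}
    (h : Relation.ReflTransGen LascarStep (clsTuple r) (clsTuple r')) {t t' : RepVar s → M}
    (ht : SameTp L (Sum.elim t t') (Sum.elim r r')) :
    LascarEquiv (clsTuple t) (clsTuple t') := by
  generalize hb : clsTuple r' = b at h
  induction h generalizing r' t' with
  -- Here `r` and `r'` may be different representatives of the same tuple, so a trivial step is
  -- copied.
  | refl => exact LascarStep.lascarEquiv hT hM hI (hb ▸ LascarStep.refl _) ht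
  | @tail b c _ hbc ih =>
    obtain ⟨q, rfl⟩ := exists_clsTuple b
    subst hb
    have hκ := hM.aleph0_lt
    have hR : IsSmallFor κ (RepVar s) := hI.sigma_fin hκ _
    -- The intermediate tuple of the chain is copied over both endpoints, so that both remaining
    -- pieces have the right type.
    obtain ⟨q', hq'⟩ := hM.saturated.exists_extend hκ.le (hR.sum hκ.le hR) ht hR q
    refine (ih (r' := q) (t' := q') ?_ rfl).trans
      (LascarStep.lascarEquiv hT hM hI hbc (t := q') (t' := t') ?_)
    · convert hq'.comp (Sum.elim (fun p => Sum.inl (Sum.inl p)) Sum.inr) using 1 <;>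
      · funext p
        cases p <;> rfl
    · convert hq'.comp (Sum.elim Sum.inr (fun p => Sum.inl (Sum.inr p))) using 1 <;>
      · funext p
        cases p <;> rfl

end Lascar

/-! ## Comparison of the automorphism groups of two monster models -/

section Comparison

variable {L : FirstOrder.Language.{u, v}}

variable (L) in
/-- The tuple `m` enumerates an elementary substructure. -/
def IsModelTuple {B : Type*} {M : Type w} [L.Structure M] (m : B → M) : Prop :=
  ∃ M₀ : L.ElementarySubstructure M, (M₀ : Set M) = Set.range m

/-- The automorphisms `f` and `f'` act in the same way on the tuples `m` and `m'`. -/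
def Corr {B : Type*} {M M' : Type*} [L.Structure M] [L.Structure M'] (m : B → M) (m' : B → M')
    (f : M ≃[L] M) (f' : M' ≃[L] M') : Prop :=
  SameTp L (Sum.elim m (f ∘ m)) (Sum.elim m' (f' ∘ m'))

variable {M : Type w} [L.Structure M] {κ : Cardinal.{w}} {M' : Type x} [L.Structure M']
  {κ' : Cardinal.{x}} {B : Type y}

theorem Corr.symm {m : B → M} {m' : B → M'} {f : M ≃[L] M} {f' : M' ≃[L] M'}
    (h : Corr m m' f f') : Corr m' m f' f :=
  SameTp.symm h

theorem IsModelTuple.mem_autf {m : B → M} (hm : IsModelTuple L m) {f : M ≃[L] M}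
    (hf : f ∘ m = m) : f ∈ Autf L M := by
  obtain ⟨M₀, hM₀⟩ := hm
  refine Subgroup.subset_closure ⟨M₀, fun c hc => ?_⟩
  have hc : c ∈ (M₀ : Set M) := hc
  rw [hM₀] at hc
  obtain ⟨b, rfl⟩ := hc
  exact congrFun hf b

/-- Saturation copies `f ∘ c` over `c'`; the copy has the type of `c'`, so homogeneity supplies the
automorphism. -/
theorem IsMonster.exists_aut_sameTp (hM' : IsMonster L κ' M') (hB : IsSmallFor κ' B)
    {c : B → M} {c' : B → M'} (h : SameTp L c c') (f : M ≃[L] M) :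
    ∃ f' : M' ≃[L] M', SameTp L (Sum.elim c (f ∘ c)) (Sum.elim c' (f' ∘ c')) := by
  obtain ⟨d, hd⟩ := hM'.saturated.exists_extend hM'.aleph0_lt.le hB h.symm hB (f ∘ c)
  obtain ⟨f', rfl⟩ := hM'.stronglyHomogeneous.exists_aut hB
    ((h.symm.trans (sameTp_aut f c)).trans hd.inr.symm)
  exact ⟨f', hd.symm⟩

/-- Homogeneity gives `g` fixing `m'` with `g (f₁ m') = f₂ m'`. Both `g` and `f₁⁻¹ g⁻¹ f₂` then fix
the model enumerated by `m'`, and `f₂ f₁⁻¹` is `g` times a conjugate of the latter. -/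
theorem Corr.mul_inv_mem_autf (hM' : IsMonster L κ' M') (hB : IsSmallFor κ' B)
    {m : B → M} {m' : B → M'} (hm' : IsModelTuple L m') {f : M ≃[L] M} {f₁ f₂ : M' ≃[L] M'}
    (h₁ : Corr m m' f f₁) (h₂ : Corr m m' f f₂) : f₂ * f₁⁻¹ ∈ Autf L M' := by
  obtain ⟨g, hg⟩ := hM'.stronglyHomogeneous.exists_aut (hB.sum hM'.aleph0_lt.le hB)
    (h₁.symm.trans h₂)
  have hg₁ : g ∈ Autf L M' := hm'.mem_autf (funext fun b => congrFun hg (Sum.inl b))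
  have hk : f₁⁻¹ * g⁻¹ * f₂ ∈ Autf L M' := hm'.mem_autf (funext fun b => by
    have h1 : g (f₁ (m' b)) = f₂ (m' b) := congrFun hg (Sum.inr b)
    change f₁.symm (g.symm (f₂ (m' b))) = m' b
    rw [← h1, g.symm_apply_apply, f₁.symm_apply_apply])
  have : f₂ * f₁⁻¹ = g * (f₁ * (f₁⁻¹ * g⁻¹ * f₂) * f₁⁻¹) := by group
  rw [this]
  exact mul_mem hg₁ ((autf_normal M').conj_mem _ hk f₁)

/-- Quotients of the automorphism groups of two monster models by corresponding subgroups are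
isomorphic. -/
theorem exists_mulEquiv_of_corr (hM : IsMonster L κ M) (hM' : IsMonster L κ' M')
    (hB : IsSmallFor κ B) (hB' : IsSmallFor κ' B) {m : B → M} {m' : B → M'}
    (hm' : IsModelTuple L m') (h : SameTp L m m') {G G' : Type*} [Group G] [Group G']
    (π : (M ≃[L] M) →* G) (hπ : Function.Surjective π) (π' : (M' ≃[L] M') →* G')
    (hπ' : Function.Surjective π') (hker' : Autf L M' ≤ π'.ker)
    (hker : ∀ f f', Corr m m' f f' → (f ∈ π.ker ↔ f' ∈ π'.ker)) :
    ∃ η : G ≃* G', ∀ f f', Corr m m' f f' → η (π f) = π' f' := by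
  choose g hg using fun f : M ≃[L] M => (hM'.exists_aut_sameTp hB' h f : ∃ f', Corr m m' f f')
  have unique : ∀ {f f₁ f₂}, Corr m m' f f₁ → Corr m m' f f₂ → π' f₁ = π' f₂ := by
    intro f f₁ f₂ h₁ h₂
    have := hker' (h₁.mul_inv_mem_autf hM' hB' hm' h₂)
    rw [MonoidHom.mem_ker, map_mul, map_inv, mul_inv_eq_one] at this
    exact this.symm
  let φ : (M ≃[L] M) →* G' := MonoidHom.mk' (fun f => π' (g f)) fun f₁ f₂ => by
    -- The chosen partner of `f₁` is controlled on `m'` only. A partner `k` on the longer tuple `(m,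
    -- f₂ m)` also makes `k * g f₂` a partner of `f₁ * f₂`.
    obtain ⟨k, hk⟩ := hM'.exists_aut_sameTp (hB'.sum hM'.aleph0_lt.le hB') (hg f₂) f₁
    have h1 : Corr m m' f₁ k := by
      unfold Corr
      convert hk.comp (Sum.map Sum.inl Sum.inl) using 1 <;>
      · funext q
        cases q <;> rfl
    have h2 : Corr m m' (f₁ * f₂) (k * g f₂) := by
      unfold Corr
      convert hk.comp (Sum.map Sum.inl Sum.inr) using 1 <;>
      · funext q
        cases q <;> rfl
    rw [unique (hg _) h2, map_mul, unique (hg f₁) h1]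
  have hφ : Function.Surjective φ := by
    intro y
    obtain ⟨f', rfl⟩ := hπ' y
    obtain ⟨f, hf⟩ := hM.exists_aut_sameTp hB h.symm f'
    exact ⟨f, unique (hg f) (Corr.symm hf)⟩
  have hφk : π.ker = φ.ker := Subgroup.ext fun f => hker f (g f) (hg f)
  refine ⟨(QuotientGroup.quotientKerEquivOfSurjective π hπ).symm.trans
    ((QuotientGroup.quotientMulEquivOfEq hφk).trans
      (QuotientGroup.quotientKerEquivOfSurjective φ hφ)), fun f f' hf => ?_⟩
  have h1 : (QuotientGroup.quotientKerEquivOfSurjective π hπ).symm (π f) = QuotientGroup.mk f :=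
    (MulEquiv.symm_apply_eq _).2 rfl
  rw [MulEquiv.trans_apply, h1]
  exact unique (hg f) hf

end Comparison

/-! ### Kernels of the maps onto the relativised groups, and their invariance under partners -/

section Fixing

variable {L : FirstOrder.Language.{u, v}} {T : L.Theory} {I : Type y} {s : I → EqSort T}
  {Sig : PartialType s}

theorem autf_le_lascarFixingCard (M : Theory.ModelType.{u, v, w} T) (lam : Cardinal.{0}) :
    Autf L M ≤ lascarFixingCard Sig M lam :=
  fun τ hτ _ => ⟨τ, hτ, rfl⟩

theorem toGalFixCard_surjective (M : Theory.ModelType.{u, v, w} T) (lam : Cardinal.{0}) :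
    Function.Surjective (toGalFixCard Sig M lam) :=
  (QuotientGroup.mk'_surjective _).comp (restrict Sig M).rangeRestrict_surjective

theorem toGalFix_surjective (M : Theory.ModelType.{u, v, w} T) :
    Function.Surjective (toGalFix Sig M) :=
  (QuotientGroup.mk'_surjective _).comp (restrict Sig M).rangeRestrict_surjective

theorem smul_realisations_eq {M : Theory.ModelType.{u, v, w} T} {f g : M ≃[L] M}
    (h : (restrict Sig M).rangeRestrict f = (restrict Sig M).rangeRestrict g)
    (a : Sig.realisations M) : f • a = g • a :=
  Equiv.congr_fun (congrArg Subtype.val h) a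

theorem smul_concat_eq {M : Theory.ModelType.{u, v, w} T} {f g : M ≃[L] M}
    (h : (restrict Sig M).rangeRestrict f = (restrict Sig M).rangeRestrict g) {K : Type z}
    (a : K → Sig.realisations M) : f • concat a = g • concat a :=
  funext fun p => congrFun (congrArg Subtype.val (smul_realisations_eq h (a p.1))) p.2

/-- The defining condition only sees the action on `Σ(M)`, so passing to restrictions does not
enlarge the subgroup. -/
theorem ker_toGalFixCard (M : Theory.ModelType.{u, v, w} T) (lam : Cardinal.{0}) :
    (toGalFixCard Sig M lam).ker = lascarFixingCard Sig M lam := by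
  ext f
  rw [toGalFixCard, MonoidHom.mem_ker, MonoidHom.comp_apply, ← MonoidHom.mem_ker,
    QuotientGroup.ker_mk', AutfFixCard, Subgroup.mem_map]
  refine ⟨?_, fun hf => ⟨f, hf, rfl⟩⟩
  rintro ⟨g, hg, hgf⟩ a
  rw [← smul_concat_eq hgf a]
  exact hg a

theorem ker_toGalFix (M : Theory.ModelType.{u, v, w} T) :
    (toGalFix Sig M).ker = lascarFixing Sig M := by
  ext f
  rw [toGalFix, MonoidHom.mem_ker, MonoidHom.comp_apply, ← MonoidHom.mem_ker,
    QuotientGroup.ker_mk', AutfFix, Subgroup.mem_map]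
  refine ⟨?_, fun hf => ⟨f, hf, rfl⟩⟩
  rintro ⟨g, hg, hgf⟩
  change LongLascarEquiv _ _
  rw [← smul_concat_eq hgf]
  exact hg

variable {M : Theory.ModelType.{u, v, w} T} {κ : Cardinal.{w}}
  {M' : Theory.ModelType.{u, v, x} T} {κ' : Cardinal.{x}} {B : Type z}

/-- Given `b` in `Σ(M')`, copy representatives `r'` of it over `m'` to `r` over `m`. A partner `f₁`
of `f` on `(m, r)` preserves the Lascar type of `b`, because `f` preserves that of the copy. As `f'`
and `f₁` are both partners of `f` on `m`, they differ by an element of `Autf(M')`. Countability of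
the tuple makes it small for both models. -/
theorem Corr.mem_lascarFixingCard (hT : T.IsComplete) (hM : IsMonster L κ M)
    (hM' : IsMonster L κ' M') (hI : IsSmallFor κ I) (hI' : IsSmallFor κ' I)
    (hB : IsSmallFor κ B) (hB' : IsSmallFor κ' B) {m : B → M} {m' : B → M'}
    (hm' : IsModelTuple L m') (h : SameTp L m m') {lam : Cardinal.{0}} (hlam : lam ≤ ℵ₀)
    {f : M ≃[L] M} {f' : M' ≃[L] M'} (hff' : Corr m m' f f')
    (hf : f ∈ lascarFixingCard Sig M lam) : f' ∈ lascarFixingCard Sig M' lam := by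
  intro b
  have hκ := hM.aleph0_lt
  have hκ' := hM'.aleph0_lt
  have : Countable lam.out := by rwa [← mk_le_aleph0_iff, mk_out]
  have hJ' : IsSmallFor κ' (lam.out × I) := (isSmallFor_of_countable hκ').prod hκ'.le hI'
  have hR : IsSmallFor κ (RepVar fun p : lam.out × I => s p.2) :=
    ((isSmallFor_of_countable hκ).prod hκ.le hI).sigma_fin hκ _
  have hR' : IsSmallFor κ' (RepVar fun p : lam.out × I => s p.2) := hJ'.sigma_fin hκ' _
  obtain ⟨r', hr'⟩ := exists_clsTuple (concat b)
  obtain ⟨r, hr⟩ := hM.saturated.exists_extend hκ.le hB h hR r'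
  let a : lam.out → Sig.realisations M := fun k =>
    ⟨clsTuple fun p => r ⟨(k, p.1), p.2⟩, by
      refine SameTp.mem_realisations (r := fun p : RepVar s => r' ⟨(k, p.1), p.2⟩)
        (hr.inr.symm.comp fun p : RepVar s => ⟨(k, p.1), p.2⟩) ?_
      have h1 : (clsTuple fun p : RepVar s => r' ⟨(k, p.1), p.2⟩) = (b k : EqTuple s M') :=
        funext fun i => congrFun hr' (k, i)
      rw [h1]
      exact (b k).2⟩
  have ha : concat a = clsTuple r := rfl
  obtain ⟨f₁, hf₁⟩ := hM'.exists_aut_sameTp (hB'.sum hκ'.le hR') hr f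
  have h1 : Corr m m' f f₁ := by
    unfold Corr
    convert hf₁.comp (Sum.map Sum.inl Sum.inl) using 1 <;>
    · funext q
      cases q <;> rfl
  have h2 : SameTp L (Sum.elim r' (f₁ ∘ r')) (Sum.elim r (f ∘ r)) := by
    convert (hf₁.comp (Sum.map Sum.inr Sum.inr)).symm using 1 <;>
    · funext q
      cases q <;> rfl
  have h3 := hf a
  rw [ha, smul_clsTuple] at h3
  have h4 := lascarEquiv_of_reflTransGen hT hM' hJ' h3.reflTransGen h2
  rw [← smul_clsTuple, hr'] at h4
  refine h4.trans ⟨f' * f₁⁻¹, h1.mul_inv_mem_autf hM' hB' hm' hff', ?_⟩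
  rw [mul_smul, inv_smul_smul]

end Fixing

/-! ## The groups given by enumerations of `Σ(M)` -/

section Enumeration

variable {L : FirstOrder.Language.{u, v}} {T : L.Theory}

/-- Compactness for Lascar equivalence by chains of a fixed length. -/
theorem longLascarEquiv_of_finite (hT : T.IsComplete) {J : Type y} {s : J → EqSort T}
    [Small.{w} (RepVar s)] {M : Theory.ModelType.{u, v, w} T} {r t : RepVar s → M} (n : ℕ)
    (h : ∀ S : Finset J, ∃ f : ℕ → RepVar s → M, f 0 = r ∧ (∀ k, RealStep L (f k) (f (k + 1))) ∧
      ∀ i ∈ S, clsTuple (f n) i = clsTuple t i) :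
    LongLascarEquiv (clsTuple r) (clsTuple t) := by
  classical
  -- The models witnessing the steps vary with the finite set of coordinates. A fixed template, here
  -- the whole of `M`, provides variables for them; its type is finitely satisfied inside each
  -- witness.
  let M₀ : L.ElementarySubstructure M := ⊤
  let m : M₀ → M := fun c => c
  -- Variables for the elements of `M`, for the tuples of the chain after the first, and for one
  -- model per step. `Shrink` keeps the resulting extension in the universe demanded by
  -- `LongLascarEquiv`.
  let V : Type w := M ⊕ ((ℕ × Shrink.{w} (RepVar s)) ⊕ (ℕ × M₀))
  let cv : ℕ → RepVar s → V := fun k p =>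
    Nat.casesOn k (Sum.inl (r p)) fun k => Sum.inr (Sum.inl (k, equivShrink _ p))
  let mv : ℕ → M₀ → V := fun k b => Sum.inr (Sum.inr (k, b))
  -- In order: the elementary diagram of `M`, the type of the template for each model, equality of
  -- types over it for each step, and equivalence of the `n`-th tuple with `t` at every coordinate.
  let F : {φ : L.Formula M // φ.Realize id} ⊕ ((ℕ × {φ : L.Formula M₀ // φ.Realize m}) ⊕
      ((ℕ × L.Formula (M₀ ⊕ RepVar s)) ⊕ J)) → L.Formula V :=
    Sum.elim (fun φ => φ.1.relabel Sum.inl) <|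
    Sum.elim (fun φ => φ.2.1.relabel (mv φ.1)) <|
    Sum.elim (fun φ => (φ.2.relabel (Sum.elim (mv φ.1) (cv φ.1))).iff
        (φ.2.relabel (Sum.elim (mv φ.1) (cv (φ.1 + 1)))))
      fun i => (s i).rel.relabel
        (Sum.elim (fun l => cv n ⟨i, l⟩) (fun l => Sum.inl (t ⟨i, l⟩)))
  obtain ⟨N, d, hd⟩ := exists_realize_family.{u, v, w, w} (T := T) F (by
    intro S
    obtain ⟨f, hf0, hf, hfn⟩ := h S.toRight.toRight.toRight
    choose P hP using hf
    choose e he using fun k => exists_realize_of_isComplete hT M M (P k) m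
      (S.toRight.toLeft.image Prod.snd)
    let d : V → M := Sum.elim id (Sum.elim (fun p => f (p.1 + 1) ((equivShrink _).symm p.2))
      fun p => e p.1 p.2)
    have hcv : ∀ k p, d (cv k p) = f k p := by
      intro k p
      cases k with
      | zero => exact (congrFun hf0 p).symm
      | succ k => simp [d, cv]
    refine ⟨M, d, ?_⟩
    rintro (φ | ⟨k, φ⟩ | ⟨k, φ⟩ | i) hi
    · change Formula.Realize (φ.1.relabel _) _
      rw [Formula.realize_relabel]
      exact φ.2
    · change Formula.Realize (φ.1.relabel _) _
      rw [Formula.realize_relabel]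
      refine he k φ (Finset.mem_image.2 ⟨(k, φ), ?_, rfl⟩)
      simpa using hi
    · change Formula.Realize ((φ.relabel _).iff (φ.relabel _)) _
      rw [Formula.realize_iff, Formula.realize_relabel, Formula.realize_relabel]
      have h1 := ((hP k).comp (Sum.map (e k) id)) φ
      convert h1 using 2
      · funext q
        rcases q with q | q
        · rfl
        · exact hcv k q
      · funext q
        rcases q with q | q
        · rfl
        · exact hcv (k + 1) q
    · change Formula.Realize ((s i).rel.relabel _) _
      rw [Formula.realize_relabel]
      have h1 := Quotient.exact (hfn i (by simpa using hi))
      change (s i).rel.Realize _ at h1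
      convert h1 using 1
      funext q
      rcases q with q | q
      · exact hcv _ _
      · rfl)
  have hdM : SameTp L id (d ∘ Sum.inl) := sameTp_of_imp fun φ hφ => by
    have := hd (Sum.inl ⟨φ, hφ⟩)
    change Formula.Realize (φ.relabel _) _ at this
    rwa [Formula.realize_relabel] at this
  let j : M ↪ₑ[L] N := ⟨d ∘ Sum.inl, fun l φ c => (hdM.comp c φ).symm⟩
  have hdm : ∀ k, SameTp L m (d ∘ mv k) := fun k => sameTp_of_imp fun φ hφ => by
    have := hd (Sum.inr (Sum.inl (k, ⟨φ, hφ⟩)))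
    change Formula.Realize (φ.relabel _) _ at this
    rwa [Formula.realize_relabel] at this
  have hds : ∀ k, SameTp L (Sum.elim (d ∘ mv k) (d ∘ cv k))
      (Sum.elim (d ∘ mv k) (d ∘ cv (k + 1))) := fun k φ => by
    have := hd (Sum.inr (Sum.inr (Sum.inl (k, φ))))
    change Formula.Realize ((φ.relabel _).iff (φ.relabel _)) _ at this
    rwa [Formula.realize_iff, Formula.realize_relabel, Formula.realize_relabel, Sum.comp_elim,
      Sum.comp_elim] at this
  have hstep : ∀ k, LascarStep (clsTuple (s := s) (d ∘ cv k)) (clsTuple (d ∘ cv (k + 1))) := by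
    intro k
    obtain ⟨N₀, hN₀⟩ := exists_elementarySubstructure_coe_eq_range M₀ (hdm k)
    have hc : ∀ c : (N₀ : Set N), ∃ b, (d ∘ mv k) b = c := fun c => by
      have : ∀ x ∈ (N₀ : Set N), ∃ b, (d ∘ mv k) b = x := fun x hx => by rwa [hN₀] at hx
      exact this c c.2
    choose g hg using hc
    refine ⟨N₀, sameType_of_sameTp ?_⟩
    convert (hds k).comp (Sum.map g id) using 1 <;>
    · funext q
      rcases q with q | q
      · exact (hg q).symm
      · rfl
  have hchain : ∀ k, Relation.ReflTransGen LascarStep (clsTuple (s := s) (d ∘ cv 0))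
      (clsTuple (d ∘ cv k)) := by
    intro k
    induction k with
    | zero => exact Relation.ReflTransGen.refl
    | succ k ih => exact ih.tail (hstep k)
  refine ⟨N, j, ?_⟩
  have h0 : mapTuple j (clsTuple r) = clsTuple (d ∘ cv 0) := rfl
  have hn : mapTuple j (clsTuple t) = clsTuple (d ∘ cv n) := by
    rw [mapTuple_clsTuple]
    refine (clsTuple_eq_iff.2 fun i => ?_).symm
    have := hd (Sum.inr (Sum.inr (Sum.inr i)))
    change Formula.Realize ((s i).rel.relabel _) _ at this
    rw [Formula.realize_relabel] at this
    convert this using 1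
    funext q
    cases q <;> rfl
  rw [h0, hn]
  exact hchain n

variable {I : Type y} {s : I → EqSort T} {Sig : PartialType s}
  {M : Theory.ModelType.{u, v, w} T} {κ : Cardinal.{w}}

theorem IsSmallFor.small {A : Type y} (hA : IsSmallFor κ A) : Small.{w} A := by
  obtain ⟨c, hc⟩ := Cardinal.mem_range_lift_of_le hA.le
  rw [← Cardinal.mk_out c, Cardinal.lift_mk_eq'] at hc
  obtain ⟨e⟩ := hc
  exact ⟨c.out, ⟨e.symm⟩⟩

/-- The chain for the whole enumeration restricts to countably many realisations, and as these form
a small tuple it can be copied from the extension back into `M`. Working with the range of `a`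
removes repetitions. -/
theorem lascarFixing_le (hT : T.IsComplete) (hM : IsMonster L κ M) (hI : IsSmallFor κ I) :
    lascarFixing Sig M ≤ lascarFixingCard Sig M ℵ₀ := by
  intro σ hσ a
  have hκ := hM.aleph0_lt
  have : Countable (ℵ₀ : Cardinal.{0}).out := by rw [← mk_le_aleph0_iff, mk_out]
  have : Countable (Set.range a) := (Set.countable_range a).to_subtype
  have hJ : IsSmallFor κ (Set.range a × I) := (isSmallFor_of_countable hκ).prod hκ.le hI
  obtain ⟨N, j, hN⟩ := LongLascarEquiv.reindex
    (fun p : Set.range a × I => ((p.1 : Sig.realisations M), p.2)) (by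
      rintro ⟨b, i⟩ ⟨b', i'⟩ h
      obtain ⟨h1, h2⟩ := Prod.mk.inj h
      exact Prod.ext (Subtype.ext h1) h2) hσ
  obtain ⟨r, hr⟩ := exists_clsTuple (concat (Subtype.val : Set.range a → Sig.realisations M))
  change Relation.ReflTransGen LascarStep
    (mapTuple j (concat (Subtype.val : Set.range a → Sig.realisations M)))
    (mapTuple j (σ • concat (Subtype.val : Set.range a → Sig.realisations M))) at hN
  rw [← hr, smul_clsTuple, mapTuple_clsTuple, mapTuple_clsTuple] at hN
  obtain ⟨τ, hτ, h⟩ := lascarEquiv_of_reflTransGen hT hM hJ hN (t := r) (t' := σ ∘ r) (by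
    have := sameTp_elementaryEmbedding j (Sum.elim r (σ ∘ r))
    rwa [Sum.comp_elim] at this)
  rw [← smul_clsTuple, hr] at h
  exact ⟨τ, hτ, funext fun p => congrFun h (⟨a p.1, p.1, rfl⟩, p.2)⟩

/-- Otherwise compactness gives for each `n` a finite set `S n` of coordinates at which no chain of
length `n` reaches the image under `σ`. A countable tuple `a` covers the realisations in all `S n`.
Some `τ` in `Autf(M)` agrees with `σ` on `a`, and the chain that `τ` yields for the whole
enumeration contradicts the choice of `S n` for its own length `n`. -/
theorem lascarFixingCard_aleph0_le (hT : T.IsComplete) (hI : IsSmallFor κ I) :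
    lascarFixingCard Sig M ℵ₀ ≤ lascarFixing Sig M := by
  classical
  intro σ hσ
  have := hI.small
  have h0 : ∀ i, Small.{w} ((s i).Carrier M) := fun i => small_self _
  have h1 : Small.{w} (EqTuple s M) := small_Pi _
  have h2 : Small.{w} (Sig.realisations M) := small_of_injective Subtype.val_injective
  have h3 : Small.{w} (RepVar fun p : Sig.realisations M × I => s p.2) := small_sigma _
  obtain ⟨r, hr⟩ := exists_clsTuple (concat fun a : Sig.realisations M => a)
  change LongLascarEquiv _ _
  rw [← hr, smul_clsTuple]
  -- Enumerating a countable set by a sequence of realisations requires at least one realisation.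
  rcases isEmpty_or_nonempty (Sig.realisations M) with hE | hE
  · have : clsTuple (σ ∘ r) = clsTuple r := funext fun p => hE.elim p.1
    rw [this]
    exact LongLascarEquiv.refl _
  by_contra hcon
  have hbad := fun n => mt (longLascarEquiv_of_finite hT (r := r) (t := σ ∘ r) n) hcon
  simp only [not_forall] at hbad
  choose S hS using hbad
  obtain ⟨a, ha⟩ := Set.countable_iff_exists_subset_range.1
    (Set.countable_iUnion fun n => ((S n).image Prod.fst).countable_toSet)
  obtain ⟨e⟩ : Nonempty ((ℵ₀ : Cardinal.{0}).out ≃ ℕ) := Cardinal.eq.1 (by simp)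
  obtain ⟨τ, hτ, h⟩ := hσ (a ∘ e)
  obtain ⟨f, n, hf0, hfn, hf⟩ :=
    exists_seq_of_reflTransGen (reflTransGen_realStep_of_mem_autf hτ r)
  refine hS n ⟨f, hf0, hf, fun p hp => ?_⟩
  obtain ⟨k, hk⟩ := ha (Set.mem_iUnion.2 ⟨n, Finset.mem_coe.2 (Finset.mem_image_of_mem _ hp)⟩)
  have h4 := congrFun h (e.symm k, p.2)
  rw [hfn, ← smul_clsTuple, ← smul_clsTuple, hr]
  obtain ⟨b, i⟩ := p
  obtain rfl : a k = b := hk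
  change τ • (concat (a ∘ e) (e.symm k, i)) = σ • (concat (a ∘ e) (e.symm k, i)) at h4
  have h5 : concat (a ∘ e) (e.symm k, i) = (a k : EqTuple s M) i :=
    congrArg (fun l => (a l : EqTuple s M) i) (e.apply_symm_apply k)
  rw [h5] at h4
  exact h4

theorem lascarFixing_eq (hT : T.IsComplete) (hM : IsMonster L κ M) (hI : IsSmallFor κ I) :
    lascarFixing Sig M = lascarFixingCard Sig M ℵ₀ :=
  le_antisymm (lascarFixing_le hT hM hI) (lascarFixingCard_aleph0_le hT hI)

end Enumeration

/-! ### Independence of the monster model -/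

section Main

variable {L : FirstOrder.Language.{u, v}} {T : L.Theory} {I : Type y} {s : I → EqSort T}
  {Sig : PartialType s} {M : Theory.ModelType.{u, v, w} T} {κ : Cardinal.{w}}
  {M' : Theory.ModelType.{u, v, x} T} {κ' : Cardinal.{x}}

/-- Quotients of the automorphism groups of two monster models by the subgroups that define the
relativised Lascar groups are isomorphic, compatibly with elementary embeddings. -/
theorem exists_mulEquiv_of_ker (hT : T.IsComplete) (hM : IsMonster L κ M) (hI : IsSmallFor κ I)
    (hM' : IsMonster L κ' M') (hI' : IsSmallFor κ' I) {lam : Cardinal.{0}} (hlam : lam ≤ ℵ₀)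
    {G G' : Type*} [Group G] [Group G'] (π : (M ≃[L] M) →* G) (hπ : Function.Surjective π)
    (π' : (M' ≃[L] M') →* G') (hπ' : Function.Surjective π')
    (hk : π.ker = lascarFixingCard Sig M lam) (hk' : π'.ker = lascarFixingCard Sig M' lam) :
    Nonempty (G ≃* G') ∧ ∀ j : M ↪ₑ[L] M', ∃ η : G ≃* G',
      ∀ (f : M ≃[L] M) (f' : M' ≃[L] M'), (∀ a : M, f' (j a) = j (f a)) → η (π f) = π' f' := by
  obtain ⟨M₀, hM₀⟩ := exists_elementarySubstructure_card_le (L := L) M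
  have hB : IsSmallFor κ M₀ := hM.isSmallFor hM₀
  have hB' : IsSmallFor κ' M₀ := hM'.isSmallFor hM₀
  let m : M₀ → M := fun c => c
  have hm : IsModelTuple L m := ⟨M₀, Subtype.range_coe.symm⟩
  have key : ∀ m' : M₀ → M', SameTp L m m' →
      ∃ η : G ≃* G', ∀ f f', Corr m m' f f' → η (π f) = π' f' := by
    intro m' h
    have hm' : IsModelTuple L m' := exists_elementarySubstructure_coe_eq_range M₀ h
    refine exists_mulEquiv_of_corr hM hM' hB hB' hm' h π hπ π' hπ'
      (hk' ▸ autf_le_lascarFixingCard M' lam) fun f f' hff' => ?_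
    rw [hk, hk']
    exact ⟨hff'.mem_lascarFixingCard hT hM hM' hI hI' hB hB' hm' h hlam,
      hff'.symm.mem_lascarFixingCard hT hM' hM hI' hI hB' hB hm h.symm hlam⟩
  constructor
  -- Without an embedding, `m'` comes from saturation of `M'` over the empty tuple, whose type is
  -- determined by completeness.
  · obtain ⟨m', hm'⟩ := hM'.saturated.exists_extend hM'.aleph0_lt.le
      (isSmallFor_of_countable (A := Empty) hM'.aleph0_lt)
      (sameTp_of_isComplete hT M' M Empty.elim Empty.elim) hB' m
    exact ⟨(key m' hm'.inr.symm).choose⟩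
  · intro j
    obtain ⟨η, hη⟩ := key (j ∘ m) (sameTp_elementaryEmbedding j m)
    refine ⟨η, fun f f' hff' => hη f f' ?_⟩
    have h1 := sameTp_elementaryEmbedding j (Sum.elim m (f ∘ m))
    rw [Sum.comp_elim] at h1
    have h2 : f' ∘ j ∘ m = j ∘ f ∘ m := funext fun b => hff' _
    -- Commuting with `j` turns `(j m, f' j m)` into the image of `(m, f m)` under `j`, which has
    -- the same type.
    rw [Corr, h2]
    exact h1

end Main

end RelLascar

theorem proposition3p4 {L : FirstOrder.Language.{u, v}} (T : L.Theory) (hT : T.IsComplete)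
    {I : Type y} (s : I → EqSort T) (Sig : PartialType s)
    (M : Theory.ModelType.{u, v, w} T) (κ : Cardinal.{w}) (hM : IsMonster L κ M)
    (hI : Cardinal.lift.{w} #I < Cardinal.lift.{y} κ)
    (M' : Theory.ModelType.{u, v, x} T) (κ' : Cardinal.{x}) (hM' : IsMonster L κ' M')
    (hI' : Cardinal.lift.{x} #I < Cardinal.lift.{y} κ') :
    (∀ lam : Cardinal.{0}, 0 < lam → lam ≤ ℵ₀ →
      Nonempty (GalFixCard Sig M lam ≃* GalFixCard Sig M' lam) ∧
      ∀ j : M ↪ₑ[L] M', ∃ η : GalFixCard Sig M lam ≃* GalFixCard Sig M' lam,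
        ∀ (f : M ≃[L] M) (f' : M' ≃[L] M'), (∀ a : M, f' (j a) = j (f a)) →
          η (toGalFixCard Sig M lam f) = toGalFixCard Sig M' lam f') ∧
    Nonempty (GalFix Sig M ≃* GalFix Sig M') ∧
    ∀ j : M ↪ₑ[L] M', ∃ η : GalFix Sig M ≃* GalFix Sig M',
      ∀ (f : M ≃[L] M) (f' : M' ≃[L] M'), (∀ a : M, f' (j a) = j (f a)) →
        η (toGalFix Sig M f) = toGalFix Sig M' f' := by
  refine ⟨fun lam _ hlam => ?_, ?_⟩
  · exact exists_mulEquiv_of_ker hT hM hI hM' hI' hlam _ (toGalFixCard_surjective M lam) _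
      (toGalFixCard_surjective M' lam) (ker_toGalFixCard M lam) (ker_toGalFixCard M' lam)
  · exact exists_mulEquiv_of_ker hT hM hI hM' hI' le_rfl _ (toGalFix_surjective M) _
      (toGalFix_surjective M') ((ker_toGalFix M).trans (lascarFixing_eq hT hM hI))
      ((ker_toGalFix M').trans (lascarFixing_eq hT hM' hI'))
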